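/- All graphs are finite, undirected and simple. A \emph{cd-coloring} of a graph $G$ is a proper coloring of $V(G)$ in which every color class is contained in the neighbourhood $N(v)$ of some vertex $v\in V(G)$. The \emph{cd-chromatic number} $\chi_{cd}(G)$ is the least number of colors in a cd-coloring of $G$, with $\chi_{cd}(G)=\infty$ if $G$ has no cd-coloring (that is, if $G$ has an isolated vertex). Let $\overline{\chi}_{cd}(G)$ be defined in the same way with closed neighbourhoods $N(v)\cup\{v\}$ in place of $N(v)$ (a vertex is then allowed to dominate itself); the two numbers agree on all graphs without isolated vertices. \textbf{Theorem.} There is an algorithm that, given the adjacency matrix of a graph $G$ on $n$ vertices, finds $\chi_{cd}(G)$ (and reports $\infty$ if $G$ has no cd-coloring) in $\mathcal{O}(2^n n^4\log n)$ time. Likewise, there is an algorithm that finds $\overline{\chi}_{cd}(G)$ in $\mathcal{O}(2^n n^4\log n)$ time. Here an algorithm is a single program, independent of $n$, for a random access machine whose words have $\mathcal{O}(n)$ bits, and time is the worst-case number of steps over all graphs on $n$ vertices. One step is one addition, truncated subtraction, multiplication or integer division of words, one loading of a constant, one indirect read or write of a memory cell, one test of a register for zero, or one idle step. -/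

import Mathlib

open Filter Asymptotics

/-! ### Class domination colorings -/

namespace SimpleGraph

variable {V : Type*}

/-- `G` has a proper coloring with `q` colors in which every color class is contained in one of the
sets `D v`, where `v` ranges over the vertices and `D v` is the set of vertices dominated by `v`. -/
def CDColorableWith (G : SimpleGraph V) (D : V → Set V) (q : ℕ) : Prop :=
  ∃ C : G.Coloring (Fin q), ∀ i : Fin q, ∃ v : V, C.colorClass i ⊆ D v

/-- The least number of colors in a proper coloring all of whose color classes are contained in
sets `D v`; it is `⊤` if there is no such coloring. -/
noncomputable def cdNumberWith (G : SimpleGraph V) (D : V → Set V) : ℕ∞ :=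
  ⨅ q ∈ {q : ℕ | G.CDColorableWith D q}, (q : ℕ∞)

/-- The class domination chromatic number: every color class must be contained in the (open)
neighbourhood of some vertex. It is `⊤` if the graph has no such coloring, that is, if it has an
isolated vertex. -/
noncomputable def cdChromaticNumber (G : SimpleGraph V) : ℕ∞ :=
  G.cdNumberWith fun v => G.neighborSet v

/-- The class domination chromatic number under the convention that a vertex dominates itself:
every color class must be contained in the closed neighbourhood of some vertex. -/
noncomputable def cdChromaticNumberClosed (G : SimpleGraph V) : ℕ∞ :=
  G.cdNumberWith fun v => insert v (G.neighborSet v)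

end SimpleGraph

/-! ### A random access machine with bounded words and unit costs -/

namespace WordRAM

/-- A state: the contents of the registers and of the main memory. A program mentions only finitely
many registers; the memory is accessed through addresses held in registers. -/
structure State where
  reg : ℕ → ℕ
  mem : ℕ → ℕ

/-- Elementary instructions. -/
inductive Instr where
  /-- `reg d := k` -/
  | const (d k : ℕ)
  /-- `reg d := reg a + reg b` -/
  | add (d a b : ℕ)
  /-- `reg d := reg a - reg b`, and `0` if `reg a < reg b` -/
  | sub (d a b : ℕ)
  /-- `reg d := reg a * reg b` -/
  | mul (d a b : ℕ)
  /-- `reg d := ⌊reg a / reg b⌋`, and `0` if `reg b = 0` -/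
  | div (d a b : ℕ)
  /-- `reg d := mem (reg a)` -/
  | load (d a : ℕ)
  /-- `mem (reg d) := reg a` -/
  | store (d a : ℕ)

/-- The value that an instruction writes. -/
def Instr.value : Instr → State → ℕ
  | .const _ k, _ => k
  | .add _ a b, s => s.reg a + s.reg b
  | .sub _ a b, s => s.reg a - s.reg b
  | .mul _ a b, s => s.reg a * s.reg b
  | .div _ a b, s => s.reg a / s.reg b
  | .load _ a, s => s.mem (s.reg a)
  | .store _ a, s => s.reg a

/-- The state after an instruction. -/
def Instr.exec (I : Instr) (s : State) : State :=
  match I with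
  | .const d _ | .add d _ _ | .sub d _ _ | .mul d _ _ | .div d _ _ | .load d _ =>
      { s with reg := Function.update s.reg d (I.value s) }
  | .store d _ => { s with mem := Function.update s.mem (s.reg d) (I.value s) }

/-- Programs. -/
inductive Prog where
  /-- do nothing -/
  | skip
  /-- perform one instruction -/
  | instr (I : Instr)
  /-- first `p`, then `q` -/
  | seq (p q : Prog)
  /-- if `reg a ≠ 0` then `p` else `q` -/
  | ite (a : ℕ) (p q : Prog)
  /-- while `reg a ≠ 0` do `p` -/
  | while (a : ℕ) (p : Prog)

/-- `Runs B p s t s'`: started in state `s`, the program `p` halts in state `s'` after exactly `t`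
steps, and every number written on the way is less than `B`. Every instruction and every test
of a register is one step. A number that is not less than `B` cannot be written: the machine is then
stuck and there is no run. -/
inductive Runs (B : ℕ) : Prog → State → ℕ → State → Prop where
  | skip (s : State) : Runs B .skip s 1 s
  | instr (I : Instr) (s : State) (h : I.value s < B) : Runs B (.instr I) s 1 (I.exec s)
  | seq {p q : Prog} {s s' s'' : State} {t t' : ℕ} (hp : Runs B p s t s')
      (hq : Runs B q s' t' s'') : Runs B (.seq p q) s (t + t') s''
  | ite_pos {a : ℕ} {p q : Prog} {s s' : State} {t : ℕ} (h : s.reg a ≠ 0)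
      (hp : Runs B p s t s') : Runs B (.ite a p q) s (t + 1) s'
  | ite_neg {a : ℕ} {p q : Prog} {s s' : State} {t : ℕ} (h : s.reg a = 0)
      (hq : Runs B q s t s') : Runs B (.ite a p q) s (t + 1) s'
  | while_stop {a : ℕ} {p : Prog} {s : State} (h : s.reg a = 0) : Runs B (.while a p) s 1 s
  | while_step {a : ℕ} {p : Prog} {s s' s'' : State} {t t' : ℕ} (h : s.reg a ≠ 0)
      (hp : Runs B p s t s') (hw : Runs B (.while a p) s' t' s'') :
      Runs B (.while a p) s (t + t' + 1) s''

open Classical in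
/-- The initial state on input `G`: the number `n` of vertices in register `0`, the adjacency matrix
row by row in the memory cells `0, …, n ^ 2 - 1`, and `0` everywhere else. -/
noncomputable def input {n : ℕ} (G : SimpleGraph (Fin n)) : State where
  reg := fun r => if r = 0 then n else 0
  mem := fun x => if ∃ i j : Fin n, G.Adj i j ∧ x = i * n + j then 1 else 0

/-- The result in a final state: `⊤` if register `0` holds `0`, otherwise the content of
register `1`. -/
def output (s : State) : ℕ∞ :=
  if s.reg 0 = 0 then ⊤ else (s.reg 1 : ℕ∞)

/-- The program `p` computes the graph parameter `f` in time `T` on words of `O(n)` bits: for some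
constant `c`, on every graph with vertex set `{0, …, n - 1}` it halts with output `f G` after at
most `T n` steps, and it never writes a number of more than `c (n + 1)` bits. -/
def ComputesInTime (p : Prog) (f : ∀ n : ℕ, SimpleGraph (Fin n) → ℕ∞) (T : ℕ → ℕ) : Prop :=
  ∃ c : ℕ, ∀ (n : ℕ) (G : SimpleGraph (Fin n)), ∃ (t : ℕ) (s : State),
    Runs (2 ^ (c * (n + 1))) p (input G) t s ∧ t ≤ T n ∧ output s = f n G

end WordRAM

/-! Encode vertex sets as `n`-bit masks and call a set admissible if it is independent and lies in
the (open or closed) neighbourhood of some vertex. Subsets of admissible sets are admissible, so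
overlaps in a cover can be removed: `G` has a cd-coloring with `q` colors iff the vertex set is a
union of `q` admissible sets (`level_ne_zero_iff`, `level_full_ne_zero_iff`).

The unions of `q + 1` admissible sets come from the unions of `q` by a cover product. The subset sum
transform turns this product into a pointwise one (`zeta_coverProduct`), because `y ∪ z ⊆ x` iff `y
⊆ x` and `z ⊆ x`. The transform and its inverse take `n` passes over `2 ^ n` cells each. Replacing
nonzero counts by `1` after every product keeps the transforms at most `2 ^ n` and their products at
most `4 ^ n`, so words of `O(n)` bits suffice.

Colorability with `q` colors is monotone in `q` when there is a vertex, and colorability with any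
number of colors implies it with `n`. Hence level `n` decides whether the number is finite, and then
the number of failing levels `q < n` is the answer (`cdNumberWith_eq`). Building the table of
admissible masks and running the `n` levels both cost `O(2 ^ n n ^ 2)` steps, within the claimed
bound.

On the machine, the adjacency matrix is followed in memory by two arrays of `2 ^ n` cells: the
transform of the admissible table, and the current level. The correctness lemmas `halts_*` are loop
invariants with step counts. -/

namespace WordRAM

/-! ### Step counting for straight-line programs and counted loops -/

/-- Started in `s`, the program `p` halts after at most `T` steps in a state satisfying `Q`. -/
def Halts (B : ℕ) (p : Prog) (s : State) (T : ℕ) (Q : State → Prop) : Prop :=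
  ∃ (t : ℕ) (s' : State), Runs B p s t s' ∧ t ≤ T ∧ Q s'

namespace Halts

variable {B T T' : ℕ} {p q : Prog} {s : State} {Q R : State → Prop}

theorem mono (h : Halts B p s T Q) (hT : T ≤ T') (hQ : ∀ s, Q s → R s) : Halts B p s T' R := by
  obtain ⟨t, s', hr, ht, hs⟩ := h
  exact ⟨t, s', hr, ht.trans hT, hQ _ hs⟩

theorem instr {I : Instr} (hv : I.value s < B) (hQ : Q (I.exec s)) :
    Halts B (.instr I) s 1 Q :=
  ⟨1, _, .instr I s hv, le_rfl, hQ⟩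

theorem seq (h : Halts B p s T fun s' => Halts B q s' T' Q) : Halts B (.seq p q) s (T + T') Q := by
  obtain ⟨t, s', hr, ht, t', s'', hr', ht', hs⟩ := h
  exact ⟨t + t', s'', .seq hr hr', by omega, hs⟩

theorem seq_of (h : Halts B p s T R) (h' : ∀ s', R s' → Halts B q s' T' Q) :
    Halts B (.seq p q) s (T + T') Q :=
  seq (h.mono le_rfl h')

end Halts

/-- Straight-line programs. -/
def block : List Instr → Prog
  | [] => .skip
  | I :: l => .seq (.instr I) (block l)

/-- All numbers written by a straight-line program are less than `B`. -/
def Fits (B : ℕ) : List Instr → State → Prop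
  | [], _ => True
  | I :: l, s => I.value s < B ∧ Fits B l (I.exec s)

/-- The effect of a straight-line program. -/
def execAll : List Instr → State → State
  | [], s => s
  | I :: l, s => execAll l (I.exec s)

theorem Halts.block {B : ℕ} {Q : State → Prop} : ∀ {l : List Instr} {s : State},
    Fits B l s → Q (execAll l s) → Halts B (block l) s (l.length + 1) Q
  | [], s, _, hQ => ⟨1, s, .skip s, le_rfl, hQ⟩
  | I :: l, s, hf, hQ =>
    ((Halts.instr (Q := fun s' => s' = I.exec s) hf.1 rfl).seq_of (q := WordRAM.block l)
      (T' := l.length + 1) (Q := Q) (by rintro _ rfl; exact Halts.block hf.2 hQ)).mono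
      (by simp only [List.length_cons]; omega) fun _ h => h

/-- Perform `body` for `reg c = reg a - 1, …, 1, 0`, where register `3` is assumed to hold `1`. -/
def forLoop (c a : ℕ) (body : Prog) : Prog :=
  .seq (.instr (.mul c a 3)) (.while c (.seq (.instr (.sub c c 3)) body))

/-- `s` with the content of register `c` replaced by `v`. -/
def State.set (s : State) (c v : ℕ) : State := { s with reg := Function.update s.reg c v }

@[simp] theorem State.set_mem (s : State) (c v : ℕ) : (s.set c v).mem = s.mem := rfl

@[simp] theorem State.set_reg_self (s : State) (c v : ℕ) : (s.set c v).reg c = v := by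
  simp [State.set]

theorem State.set_reg_of_ne (s : State) {c r : ℕ} (v : ℕ) (h : r ≠ c) :
    (s.set c v).reg r = s.reg r := by
  simp [State.set, h]

/-- Each round costs a test, a decrement and the body; the extra `2` pays for copying `reg a` (a
multiplication by `reg 3 = 1`) and for the last test. The loop writes its counter itself, so `Inv`
has to survive any change of `reg c`. -/
theorem Halts.forLoop {B c a N T : ℕ} {body : Prog} {s : State} (Inv : ℕ → State → Prop)
    (h3 : s.reg 3 = 1) (ha : s.reg a = N) (hN : N < B)
    (hset : ∀ i s v, Inv i s → Inv i (s.set c v)) (hone : ∀ i s, Inv i s → s.reg 3 = 1)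
    (hinit : Inv N s)
    (hstep : ∀ i < N, ∀ s, Inv (i + 1) s → s.reg c = i →
      Halts B body s T fun s' => s'.reg c = i ∧ Inv i s') :
    Halts B (forLoop c a body) s (N * (T + 2) + 2) (Inv 0) := by
  have key : ∀ k ≤ N, ∀ s, s.reg c = k → Inv k s →
      Halts B (.while c (.seq (.instr (.sub c c 3)) body)) s (k * (T + 2) + 1) (Inv 0) := by
    intro k
    induction k with
    | zero => exact fun _ s hs hI => ⟨1, s, by constructor; exact hs, by omega, hI⟩
    | succ k ih =>
      intro hk s hs hI
      have h1 : Halts B (.seq (.instr (.sub c c 3)) body) s (1 + T)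
          fun s' => s'.reg c = k ∧ Inv k s' := by
        refine (Halts.instr (Q := fun s' => s' = s.set c k) ?_ ?_).seq_of ?_
        · simp only [Instr.value, hs, hone _ _ hI]; omega
        · simp [Instr.exec, Instr.value, State.set, hs, hone _ _ hI]
        · rintro _ rfl
          exact hstep k (by omega) _ (hset _ _ _ hI) (by simp)
      obtain ⟨t, s', hr, ht, hs', hI'⟩ := h1
      obtain ⟨t', s'', hr', ht', hI''⟩ := ih (by omega) s' hs' hI'
      exact ⟨t + t' + 1, s'', .while_step (by omega) hr hr', by rw [Nat.succ_mul]; omega, hI''⟩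
  refine ((Halts.instr (Q := fun s' => s' = s.set c N) ?_ ?_).seq_of
    (T' := N * (T + 2) + 1) ?_).mono (by omega) fun _ h => h
  · simpa [Instr.value, ha, h3] using hN
  · simp [Instr.exec, Instr.value, State.set, ha, h3]
  · rintro _ rfl
    exact key N le_rfl _ (by simp) (hset _ _ _ hinit)

/-- A loop that fills the `N` cells from `base` on, from the last to the first, with values `φ i`,
changing no register below its counter `c`. -/
theorem Halts.mapLoop {B c a N T base : ℕ} {body : Prog} {s₀ : State} (φ : ℕ → ℕ)
    (hc : 3 < c) (h3 : s₀.reg 3 = 1) (ha : s₀.reg a = N) (hN : N < B)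
    (hstep : ∀ i < N, ∀ s, (∀ r < c, s.reg r = s₀.reg r) → s.reg c = i →
      (∀ y, y < base + (i + 1) ∨ base + N ≤ y → s.mem y = s₀.mem y) →
      Halts B body s T fun s' => (∀ r < c + 1, s'.reg r = s.reg r) ∧
        s'.mem = Function.update s.mem (base + i) (φ i)) :
    Halts B (WordRAM.forLoop c a body) s₀ (N * (T + 2) + 2) fun s =>
      (∀ r < c, s.reg r = s₀.reg r) ∧ (∀ x < N, s.mem (base + x) = φ x) ∧
      ∀ y, y < base ∨ base + N ≤ y → s.mem y = s₀.mem y := by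
  refine (Halts.forLoop (fun i s => (∀ r < c, s.reg r = s₀.reg r) ∧
      (∀ x < N, i ≤ x → s.mem (base + x) = φ x) ∧
      ∀ y, y < base + i ∨ base + N ≤ y → s.mem y = s₀.mem y)
    h3 ha hN ?_ ?_ ?_ ?_).mono le_rfl ?_
  · rintro i s v ⟨h1, h2⟩
    exact ⟨fun r hr => by rw [State.set_reg_of_ne _ _ (by omega), h1 r hr], h2⟩
  · rintro i s ⟨h1, -⟩
    rw [h1 3 hc, h3]
  · exact ⟨fun _ _ => rfl, fun x hx hx' => by omega, fun _ _ => rfl⟩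
  · rintro i hi s ⟨h1, h2, h4⟩ hs
    refine (hstep i hi s h1 hs h4).mono le_rfl ?_
    rintro s' ⟨h5, h6⟩
    refine ⟨by rw [h5 c (by omega), hs], fun r hr => by rw [h5 r (by omega), h1 r hr], ?_, ?_⟩
    · intro x hx hix
      rw [h6]
      rcases eq_or_ne x i with rfl | hne
      · simp
      · rw [Function.update_of_ne (by omega), h2 x hx (by omega)]
    · intro y hy
      rw [h6, Function.update_of_ne (by omega), h4 y (by omega)]
  · rintro s ⟨h1, h2, h4⟩
    exact ⟨h1, fun x hx => h2 x hx (Nat.zero_le _), fun y hy => h4 y (by omega)⟩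

end WordRAM

/-! ### Subset sums over bit masks -/

namespace BitMask

/-- The digit of `x` at the place with value `p`, in base two. -/
def digit (x p : ℕ) : ℕ := x / p - x / p / 2 * 2

theorem digit_eq_mod (x p : ℕ) : digit x p = x / p % 2 := by
  unfold digit; omega

theorem digit_le_one (x p : ℕ) : digit x p ≤ 1 := by
  rw [digit_eq_mod]; omega

theorem digit_two_pow (x i : ℕ) : digit x (2 ^ i) = if x.testBit i then 1 else 0 := by
  rw [digit_eq_mod, Nat.testBit_eq_decide_div_mod_eq]
  simp only [decide_eq_true_eq]
  split <;> omega

/-- The partial sum over the subsets that differ from `x` at most in the place with value `p`. -/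
def zetaPass (p : ℕ) (f : ℕ → ℕ) (x : ℕ) : ℕ := f x + f (x - digit x p * p) * digit x p

/-- The inverse of `zetaPass`. -/
def moebiusPass (p : ℕ) (f : ℕ → ℕ) (x : ℕ) : ℕ := f x - f (x - digit x p * p) * digit x p

/-- The partner cell of `x` in a pass has digit `0`, so the pass leaves it unchanged; this is what
makes a pass invertible. -/
theorem digit_sub_digit_mul {x p : ℕ} (h : digit x p = 1) : digit (x - p) p = 0 := by
  rw [digit_eq_mod] at *
  rcases Nat.eq_zero_or_pos p with rfl | hp
  · simp
  have : (x - p * 1) / p = x / p - 1 := Nat.sub_mul_div x p 1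
  rw [mul_one] at this
  omega

/-- Truncation does no harm: the amount subtracted is exactly the one that was added. -/
theorem moebiusPass_zetaPass (p : ℕ) (f : ℕ → ℕ) : moebiusPass p (zetaPass p f) = f := by
  funext x
  unfold moebiusPass zetaPass
  rcases Nat.le_one_iff_eq_zero_or_eq_one.1 (digit_le_one x p) with h | h
  · simp [h]
  · simp [h, digit_sub_digit_mul h]

/-- The partial sums over the subsets that differ from a mask only in its last `i` bits. -/
def zeta (f : ℕ → ℕ) : ℕ → ℕ → ℕ
  | 0 => f
  | i + 1 => zetaPass (2 ^ i) (zeta f i)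

theorem moebiusPass_zeta (f : ℕ → ℕ) (i : ℕ) : moebiusPass (2 ^ i) (zeta f (i + 1)) = zeta f i :=
  moebiusPass_zetaPass _ _

/-- `y` is a subset of `x`, equal to `x` except possibly in the last `i` bits. -/
def Below (i y x : ℕ) : Prop :=
  ∀ k, (y.testBit k = true → x.testBit k = true) ∧
    (i ≤ k → x.testBit k = true → y.testBit k = true)

/-- Subtracting a power of two whose bit is set causes no borrow, so it clears just that bit. -/
theorem testBit_sub_two_pow {x i : ℕ} (h : x.testBit i = true) (k : ℕ) :
    (x - 2 ^ i).testBit k = (x.testBit k && decide (k ≠ i)) := by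
  have hle : 2 ^ i ≤ x := Nat.ge_two_pow_of_testBit h
  obtain ⟨y, rfl⟩ := Nat.exists_eq_add_of_le hle
  rw [Nat.add_sub_cancel_left]
  rcases lt_trichotomy k i with hk | rfl | hk
  · rw [Nat.testBit_two_pow_add_gt hk]; simp [hk.ne]
  · rw [Nat.testBit_two_pow_add_eq] at h; simpa using h
  · obtain ⟨m, rfl⟩ := Nat.exists_eq_add_of_lt hk
    have e : i + m + 1 = (m + 1) + i := by omega
    have h2 : (2 ^ i + y) / 2 ^ i = y / 2 ^ i + 1 := by
      rw [Nat.add_div_left _ (by positivity)]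
    rw [Nat.testBit_two_pow_add_eq] at h
    rw [Nat.testBit_eq_decide_div_mod_eq] at h
    simp only [Bool.not_eq_true', decide_eq_false_iff_not] at h
    rw [e, Nat.testBit_add y, Nat.testBit_add (2 ^ i + y), h2, Nat.testBit_add_one,
      Nat.testBit_add_one]
    have h3 : (y / 2 ^ i + 1) / 2 = y / 2 ^ i / 2 := by omega
    rw [h3]
    simp

theorem below_succ_iff_of_not {i y x : ℕ} (h : x.testBit i = false) :
    Below (i + 1) y x ↔ Below i y x := by
  refine ⟨fun H k => ⟨(H k).1, fun hk hx => ?_⟩, fun H k => ⟨(H k).1, fun hk => (H k).2 (by omega)⟩⟩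
  rcases hk.eq_or_lt with rfl | hk
  · simp [h] at hx
  · exact (H k).2 hk hx

theorem below_succ_iff_of_testBit {i y x : ℕ} (h : x.testBit i = true) :
    Below (i + 1) y x ↔ Below i y x ∨ Below i y (x - 2 ^ i) := by
  constructor
  · intro H
    by_cases hy : y.testBit i = true
    · left
      refine fun k => ⟨(H k).1, fun hk hx => ?_⟩
      rcases hk.eq_or_lt with rfl | hk
      · exact hy
      · exact (H k).2 hk hx
    · right
      intro k
      rw [testBit_sub_two_pow h]
      simp only [Bool.and_eq_true, decide_eq_true_eq]
      refine ⟨fun hk => ⟨(H k).1 hk, ?_⟩, fun hk hx => (H k).2 (by omega) hx.1⟩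
      rintro rfl
      exact hy hk
  · rintro (H | H)
    · exact fun k => ⟨(H k).1, fun hk => (H k).2 (by omega)⟩
    · intro k
      have Hk := H k
      rw [testBit_sub_two_pow h] at Hk
      simp only [Bool.and_eq_true, decide_eq_true_eq] at Hk
      exact ⟨fun hk => (Hk.1 hk).1, fun hk hx => Hk.2 (by omega) ⟨hx, by omega⟩⟩

theorem not_below_and_below_sub {i y x : ℕ} (h : x.testBit i = true)
    (h1 : Below i y x) (h2 : Below i y (x - 2 ^ i)) : False := by
  have := (h2 i).1 ((h1 i).2 le_rfl h)
  simp [testBit_sub_two_pow h] at this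

-- Induction on the passes. If bit `i` of `x` is set, the masks newly reachable are those without
-- bit `i`, and they are counted by the partner `x - 2 ^ i`; the two families are disjoint. For `i =
-- n` the sum runs over all subsets of `x`.
open Classical in
theorem zeta_eq_sum (f : ℕ → ℕ) {n : ℕ} (i : ℕ) : ∀ x < 2 ^ n,
    zeta f i x = ∑ y ∈ Finset.range (2 ^ n), if Below i y x then f y else 0 := by
  induction i with
  | zero =>
    intro x hx
    have : ∀ y, Below 0 y x ↔ y = x := fun y =>
      ⟨fun H => Nat.eq_of_testBit_eq fun k => Bool.eq_iff_iff.2 ⟨(H k).1, (H k).2 (by omega)⟩,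
        by rintro rfl k; simp⟩
    simp [zeta, this, hx]
  | succ i ih =>
    intro x hx
    rw [zeta, zetaPass, digit_two_pow]
    by_cases h : x.testBit i = true
    · simp only [h, if_true, one_mul, mul_one]
      rw [ih x hx, ih (x - 2 ^ i) ((Nat.sub_le _ _).trans_lt hx), ← Finset.sum_add_distrib]
      refine Finset.sum_congr rfl fun y _ => ?_
      rw [if_congr (below_succ_iff_of_testBit h) rfl rfl]
      have := not_below_and_below_sub (y := y) h
      by_cases h1 : Below i y x <;> by_cases h2 : Below i y (x - 2 ^ i) <;> simp_all
    · simp only [h]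
      rw [Bool.not_eq_true] at h
      simp [below_succ_iff_of_not h, ih x hx]

theorem zeta_le (f : ℕ → ℕ) {n K : ℕ} (hf : ∀ x < 2 ^ n, f x ≤ K) {i x : ℕ} (hx : x < 2 ^ n) :
    zeta f i x ≤ 2 ^ n * K := by
  classical
  rw [zeta_eq_sum f i x hx]
  calc _ ≤ ∑ y ∈ Finset.range (2 ^ n), K := Finset.sum_le_sum fun y hy => by
        split
        · exact hf y (Finset.mem_range.1 hy)
        · exact Nat.zero_le _
    _ = _ := by simp

/-- Guarantees that the intermediate arrays of the inverse transform fit in a word as soon as its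
input does. -/
theorem zeta_mono (f : ℕ → ℕ) {i j : ℕ} (h : i ≤ j) (x : ℕ) : zeta f i x ≤ zeta f j x := by
  induction h with
  | refl => exact le_rfl
  | step _ ih => exact ih.trans (Nat.le_add_right _ _)

/-- The number of ways, weighted by `f` and `g`, to write the `n`-bit mask `x` as a union. -/
def coverProduct (n : ℕ) (f g : ℕ → ℕ) (x : ℕ) : ℕ :=
  ∑ y ∈ Finset.range (2 ^ n), ∑ z ∈ Finset.range (2 ^ n), if y ||| z = x then f y * g z else 0

theorem below_or_iff {n x y z : ℕ} (hx : x < 2 ^ n) :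
    Below n (y ||| z) x ↔ Below n y x ∧ Below n z x := by
  -- An `n`-bit mask has no bits from `n` on, so the second clause of `Below n` is vacuous and the
  -- relation is plain inclusion.
  have hk : ∀ k, n ≤ k → x.testBit k = true → False := fun k hk h => by
    rw [Nat.testBit_lt_two_pow (hx.trans_le (Nat.pow_le_pow_right (by omega) hk))] at h
    cases h
  constructor
  · exact fun H => ⟨fun k => ⟨fun h => (H k).1 (by simp [h]), fun h h' => (hk k h h').elim⟩,
      fun k => ⟨fun h => (H k).1 (by simp [h]), fun h h' => (hk k h h').elim⟩⟩
  · rintro ⟨H1, H2⟩ k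
    refine ⟨fun h => ?_, fun h h' => (hk k h h').elim⟩
    rw [Nat.testBit_or, Bool.or_eq_true] at h
    exact h.elim (H1 k).1 (H2 k).1

/-- Summing over all unions `w ⊆ x` leaves each pair `(y, z)` with `y ∪ z ⊆ x` exactly once, and
that condition separates into one on `y` and one on `z`. -/
theorem zeta_coverProduct (f g : ℕ → ℕ) {n x : ℕ} (hx : x < 2 ^ n) :
    zeta (coverProduct n f g) n x = zeta f n x * zeta g n x := by
  classical
  rw [zeta_eq_sum _ n x hx, zeta_eq_sum f n x hx, zeta_eq_sum g n x hx, Finset.sum_mul_sum]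
  simp only [coverProduct]
  have e : ∀ w, (if Below n w x then ∑ y ∈ Finset.range (2 ^ n), ∑ z ∈ Finset.range (2 ^ n),
      (if y ||| z = w then f y * g z else 0) else 0) =
      ∑ y ∈ Finset.range (2 ^ n), ∑ z ∈ Finset.range (2 ^ n),
        if y ||| z = w then (if Below n w x then f y * g z else 0) else 0 := by
    intro w
    by_cases h : Below n w x <;> simp [h]
  simp only [e]
  rw [Finset.sum_comm]
  refine Finset.sum_congr rfl fun y hy => ?_
  rw [Finset.sum_comm]
  refine Finset.sum_congr rfl fun z hz => ?_
  have hyz : y ||| z < 2 ^ n := Nat.or_lt_two_pow (Finset.mem_range.1 hy) (Finset.mem_range.1 hz)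
  rw [Finset.sum_ite_eq, if_pos (Finset.mem_range.2 hyz), if_congr (below_or_iff hx) rfl rfl]
  by_cases h1 : Below n y x <;> by_cases h2 : Below n z x <;> simp [h1, h2]

/-- `1` if the `n`-bit mask `x` is a union of `q` masks with `g` equal to `1`, otherwise `0`. -/
def level (n : ℕ) (g : ℕ → ℕ) : ℕ → ℕ → ℕ
  | 0, x => 1 - x
  | q + 1, x => 1 - (1 - coverProduct n (level n g q) g x)

theorem level_le_one (n : ℕ) (g : ℕ → ℕ) (q x : ℕ) : level n g q x ≤ 1 := by
  cases q <;> simp [level]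

theorem level_zero_ne_zero_iff {n : ℕ} {g : ℕ → ℕ} {x : ℕ} : level n g 0 x ≠ 0 ↔ x = 0 := by
  simp only [level]; omega

theorem level_succ_ne_zero_iff {n : ℕ} {g : ℕ → ℕ} {q x : ℕ} :
    level n g (q + 1) x ≠ 0 ↔
      ∃ y < 2 ^ n, ∃ z < 2 ^ n, y ||| z = x ∧ level n g q y ≠ 0 ∧ g z ≠ 0 := by
  have : level n g (q + 1) x ≠ 0 ↔ coverProduct n (level n g q) g x ≠ 0 := by
    simp only [level]; omega
  rw [this, coverProduct]
  simp [Finset.sum_eq_zero_iff]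

end BitMask

/-! ### Masks as vertex sets, and covers by members of a hereditary family -/

namespace BitMask

/-- The set with indicator function the last `n` bits of `x`. -/
def maskSet (n x : ℕ) : Set (Fin n) := {v | x.testBit v = true}

theorem exists_maskSet_eq {n : ℕ} (S : Set (Fin n)) : ∃ x < 2 ^ n, maskSet n x = S := by
  classical
  exact ⟨Nat.ofBits fun v : Fin n => decide (v ∈ S), Nat.ofBits_lt_two_pow _, by
    ext v; simp [maskSet]⟩

theorem maskSet_or (n x y : ℕ) : maskSet n (x ||| y) = maskSet n x ∪ maskSet n y := by
  ext v; simp [maskSet]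

theorem maskSet_injOn {n x y : ℕ} (hx : x < 2 ^ n) (hy : y < 2 ^ n)
    (h : maskSet n x = maskSet n y) : x = y := by
  refine Nat.eq_of_testBit_eq fun k => ?_
  rcases lt_or_ge k n with hk | hk
  · exact Bool.eq_iff_iff.2 (Set.ext_iff.1 h ⟨k, hk⟩)
  · have hle : 2 ^ n ≤ 2 ^ k := Nat.pow_le_pow_right (by omega) hk
    rw [Nat.testBit_lt_two_pow (hx.trans_le hle), Nat.testBit_lt_two_pow (hy.trans_le hle)]

theorem maskSet_zero (n : ℕ) : maskSet n 0 = ∅ := by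
  ext v; simp [maskSet]

theorem maskSet_full (n : ℕ) : maskSet n (2 ^ n - 1) = Set.univ := by
  ext v; simp [maskSet]

/-- Heredity turns covers into partitions: in a union `y ∪ z` the vertices of `y` keep their colors
and only those of `z` outside `y` get the new color `q`. Conversely, the class of color `q` is split
off as `z`. -/
theorem level_ne_zero_iff {n : ℕ} {g : ℕ → ℕ} {P : Set (Fin n) → Prop}
    (hP : ∀ S T, S ⊆ T → P T → P S) (hg : ∀ x < 2 ^ n, g x ≠ 0 ↔ P (maskSet n x)) (q : ℕ) :
    ∀ x < 2 ^ n, level n g q x ≠ 0 ↔ ∃ c : Fin n → ℕ, (∀ v ∈ maskSet n x, c v < q) ∧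
      ∀ k < q, P {v | v ∈ maskSet n x ∧ c v = k} := by
  induction q with
  | zero =>
    intro x hx
    rw [level_zero_ne_zero_iff]
    constructor
    · rintro rfl
      exact ⟨fun _ => 0, by simp [maskSet_zero], by simp⟩
    · rintro ⟨c, hc, -⟩
      refine maskSet_injOn hx (by positivity) ?_
      rw [maskSet_zero]
      exact Set.eq_empty_of_forall_notMem fun v hv => absurd (hc v hv) (by omega)
  | succ q ih =>
    intro x hx
    rw [level_succ_ne_zero_iff]
    constructor
    · rintro ⟨y, hy, z, hz, rfl, h1, h2⟩
      obtain ⟨c, hc, hcP⟩ := (ih y hy).1 h1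
      have h2 := (hg z hz).1 h2
      classical
      refine ⟨fun v => if v ∈ maskSet n y then c v else q, fun v _ => ?_, fun k hk => ?_⟩
      · dsimp only
        split
        · exact (hc v ‹_›).trans (by omega)
        · omega
      · rcases Nat.lt_succ_iff_lt_or_eq.1 hk with hk | rfl
        · refine hP _ _ ?_ (hcP k hk)
          rintro v ⟨-, hv⟩
          dsimp only at hv
          split at hv
          · exact ⟨‹_›, hv⟩
          · omega
        · refine hP _ _ ?_ h2
          rintro v ⟨hv, hvk⟩
          rw [maskSet_or] at hv
          dsimp only at hvk
          split at hvk
          · rename_i hvy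
            exact absurd (hc v hvy) (by omega)
          · exact hv.resolve_left ‹_›
    · rintro ⟨c, hc, hcP⟩
      obtain ⟨y, hy, hyS⟩ := exists_maskSet_eq {v | v ∈ maskSet n x ∧ c v < q}
      obtain ⟨z, hz, hzS⟩ := exists_maskSet_eq {v | v ∈ maskSet n x ∧ c v = q}
      refine ⟨y, hy, z, hz, maskSet_injOn (Nat.or_lt_two_pow hy hz) hx ?_, ?_, ?_⟩
      · rw [maskSet_or, hyS, hzS]
        ext v
        simp only [Set.mem_union, Set.mem_ofPred_eq]
        constructor
        · rintro (h | h) <;> exact h.1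
        · intro h
          have := hc v h
          rcases Nat.lt_succ_iff_lt_or_eq.1 this with h' | h'
          · exact .inl ⟨h, h'⟩
          · exact .inr ⟨h, h'⟩
      · refine (ih y hy).2 ⟨c, fun v hv => ?_, fun k hk => hP _ _ ?_ (hcP k (by omega))⟩
        · rw [hyS] at hv
          exact hv.2
        · rintro v ⟨hv, hk⟩
          rw [hyS] at hv
          exact ⟨hv.1, hk⟩
      · rw [hg z hz, hzS]
        exact hcP q (by omega)

/-- The number of ordered pairs of adjacent vertices in a mask, for the adjacency matrix `a`. -/
def edgeCount (n : ℕ) (a : ℕ → ℕ) (x : ℕ) : ℕ :=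
  ∑ i ∈ Finset.range n, ∑ j ∈ Finset.range n, digit x (2 ^ i) * digit x (2 ^ j) * a (i * n + j)

/-- The number of elements of a mask that `i` does not dominate; every vertex dominates itself
if `b` is `1`. -/
def missed (n b : ℕ) (a : ℕ → ℕ) (x i : ℕ) : ℕ :=
  ∑ j ∈ Finset.range n, (1 - (a (i * n + j) + (1 - (i - j + (j - i))) * b)) * digit x (2 ^ j)

/-- The number of vertices that dominate all elements of a mask. -/
def dominatorCount (n b : ℕ) (a : ℕ → ℕ) (x : ℕ) : ℕ :=
  ∑ i ∈ Finset.range n, (1 - missed n b a x i)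

/-- `1` if the mask is an independent set contained in the neighbourhood of some vertex,
otherwise `0`. -/
def admissible (n b : ℕ) (a : ℕ → ℕ) (x : ℕ) : ℕ :=
  (1 - edgeCount n a x) * (1 - (1 - dominatorCount n b a x))

theorem admissible_le_one (n b : ℕ) (a : ℕ → ℕ) (x : ℕ) : admissible n b a x ≤ 1 :=
  (Nat.mul_le_mul (Nat.sub_le _ _) (Nat.sub_le _ _)).trans_eq (one_mul 1)

end BitMask

/-! ### Class domination colorings in terms of levels -/

namespace SimpleGraph

variable {n : ℕ}

/-- The neighbourhood of `v`, closed if `b ≠ 0`. -/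
def dominated (G : SimpleGraph (Fin n)) (b : ℕ) (v : Fin n) : Set (Fin n) :=
  {u | G.Adj v u ∨ b ≠ 0 ∧ u = v}

/-- A possible color class. -/
def IsClass (G : SimpleGraph (Fin n)) (b : ℕ) (S : Set (Fin n)) : Prop :=
  (∀ u ∈ S, ∀ v ∈ S, ¬ G.Adj u v) ∧ ∃ v, S ⊆ G.dominated b v

theorem IsClass.mono {G : SimpleGraph (Fin n)} {b : ℕ} {S T : Set (Fin n)} (h : S ⊆ T)
    (hT : G.IsClass b T) : G.IsClass b S :=
  ⟨fun u hu v hv => hT.1 u (h hu) v (h hv), hT.2.imp fun _ => h.trans⟩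

-- Division with remainder by `n` recovers `i` and `j` from the address.
open Classical in
theorem input_mem (G : SimpleGraph (Fin n)) (i j : Fin n) :
    (WordRAM.input G).mem (i * n + j) = if G.Adj i j then 1 else 0 := by
  simp only [WordRAM.input]
  refine if_congr ⟨?_, fun h => ⟨i, j, h, rfl⟩⟩ rfl rfl
  rintro ⟨i', j', h, e⟩
  have hn : 0 < n := i.pos
  have h1 : (i : ℕ) = i' := by
    have := congrArg (· / n) e
    simpa [Nat.add_div_of_dvd_right, Nat.mul_div_cancel _ hn, Nat.div_eq_of_lt] using this
  have h2 : (j : ℕ) = j' := by rw [h1] at e; omega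
  rwa [Fin.ext h1, Fin.ext h2]

/-- A sum of natural numbers vanishes iff every term does, and `1 - ·` acts as negation, so the
arithmetic formula mirrors the quantifiers in `IsClass`. -/
theorem admissible_ne_zero_iff (G : SimpleGraph (Fin n)) (b x : ℕ) :
    BitMask.admissible n b (WordRAM.input G).mem x ≠ 0 ↔ G.IsClass b (BitMask.maskSet n x) := by
  classical
  have h1 : BitMask.edgeCount n (WordRAM.input G).mem x = 0 ↔
      ∀ u ∈ BitMask.maskSet n x, ∀ v ∈ BitMask.maskSet n x, ¬ G.Adj u v := by
    simp only [BitMask.edgeCount, Finset.sum_range, input_mem, Finset.sum_eq_zero_iff,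
      BitMask.digit_two_pow, BitMask.maskSet, Set.mem_ofPred_eq, Finset.mem_univ, true_imp_iff]
    refine forall_congr' fun u => ?_
    rw [forall_comm]
    by_cases hu : x.testBit u = true
    · simp only [hu, if_true, one_mul]
      refine forall_congr' fun v => ?_
      by_cases hv : x.testBit v = true <;> simp [hv]
    · simp [hu]
  have h2 : ∀ i : Fin n, BitMask.missed n b (WordRAM.input G).mem x i = 0 ↔
      BitMask.maskSet n x ⊆ G.dominated b i := by
    intro i
    simp only [BitMask.missed, Finset.sum_range, input_mem, Finset.sum_eq_zero_iff,
      BitMask.digit_two_pow, BitMask.maskSet, dominated, Set.ofPred_subset_ofPred, Finset.mem_univ,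
      true_imp_iff]
    refine forall_congr' fun j => ?_
    by_cases hj : x.testBit j = true
    · by_cases hA : G.Adj i j
      · simp [hj, hA]
      · by_cases hij : j = i
        · simp [hij, Nat.one_le_iff_ne_zero, Nat.sub_eq_zero_iff_le]
        · have : 1 - ((i : ℕ) - j + (j - i)) = 0 := by
            have : (j : ℕ) ≠ i := fun h => hij (Fin.ext h)
            omega
          simp [hj, hA, hij, this]
    · simp [hj]
  have h3 : BitMask.dominatorCount n b (WordRAM.input G).mem x ≠ 0 ↔
      ∃ v, BitMask.maskSet n x ⊆ G.dominated b v := by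
    rw [BitMask.dominatorCount, Finset.sum_range, Ne, Finset.sum_eq_zero_iff]
    simp only [Finset.mem_univ, true_imp_iff, not_forall, ← h2]
    exact exists_congr fun i => by omega
  rw [IsClass, ← h1, ← h3, BitMask.admissible, mul_ne_zero_iff]
  omega

theorem cdColorableWith_iff (G : SimpleGraph (Fin n)) (b q : ℕ) :
    G.CDColorableWith (G.dominated b) q ↔
      ∃ c : Fin n → ℕ, (∀ v, c v < q) ∧ ∀ k < q, G.IsClass b {v | c v = k} := by
  constructor
  · rintro ⟨C, hC⟩
    refine ⟨fun v => C v, fun v => (C v).2, fun k hk => ⟨?_, ?_⟩⟩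
    · intro u hu v hv h
      exact C.valid h (Fin.ext (hu.trans hv.symm))
    · obtain ⟨v, hv⟩ := hC ⟨k, hk⟩
      exact ⟨v, fun u hu => hv (Fin.ext hu)⟩
  · rintro ⟨c, hc, h⟩
    refine ⟨Coloring.mk (fun v => ⟨c v, hc v⟩) ?_, fun k => ?_⟩
    · intro u v huv e
      exact (h (c v) (hc v)).1 u (by simpa using e) v rfl huv
    · obtain ⟨v, hv⟩ := (h k k.2).2
      exact ⟨v, fun u hu => hv (congrArg Fin.val hu)⟩

theorem level_full_ne_zero_iff (G : SimpleGraph (Fin n)) (b q : ℕ) :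
    BitMask.level n (BitMask.admissible n b (WordRAM.input G).mem) q (2 ^ n - 1) ≠ 0 ↔
      G.CDColorableWith (G.dominated b) q := by
  rw [BitMask.level_ne_zero_iff (P := G.IsClass b) (fun _ _ => IsClass.mono)
    (fun x _ => G.admissible_ne_zero_iff b x) q _ (Nat.sub_lt (by positivity) one_pos),
    cdColorableWith_iff]
  simp [BitMask.maskSet_full]

/-- The additional color class is empty, but some vertex must still exist to dominate it. -/
theorem CDColorableWith.succ {G : SimpleGraph (Fin n)} {b q : ℕ} (hn : 0 < n)
    (h : G.CDColorableWith (G.dominated b) q) : G.CDColorableWith (G.dominated b) (q + 1) := by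
  rw [cdColorableWith_iff] at h ⊢
  obtain ⟨c, hc, h⟩ := h
  refine ⟨c, fun v => (hc v).trans (by omega), fun k hk => ?_⟩
  rcases Nat.lt_succ_iff_lt_or_eq.1 hk with hk | rfl
  · exact h k hk
  · have : {v | c v = k} = ∅ := Set.eq_empty_of_forall_notMem fun v hv => (hc v).ne hv
    rw [this]
    exact ⟨by simp, ⟨0, hn⟩, by simp⟩

/-- Give each vertex its own color: a singleton is a subset of an old class. -/
theorem CDColorableWith.card {G : SimpleGraph (Fin n)} {b q : ℕ}
    (h : G.CDColorableWith (G.dominated b) q) : G.CDColorableWith (G.dominated b) n := by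
  rw [cdColorableWith_iff] at h ⊢
  obtain ⟨c, hc, h⟩ := h
  refine ⟨fun v => v, fun v => v.2, fun k hk => (h (c ⟨k, hk⟩) (hc _)).mono ?_⟩
  rintro v rfl
  rfl

open Finset in
theorem cdNumberWith_eq (G : SimpleGraph (Fin n)) (b : ℕ) {l : ℕ → ℕ} (hl : ∀ q, l q ≤ 1)
    (h : ∀ q, l q ≠ 0 ↔ G.CDColorableWith (G.dominated b) q) :
    G.cdNumberWith (G.dominated b) =
      if l n = 0 then ⊤ else ((∑ q ∈ range n, (1 - l q) : ℕ) : ℕ∞) := by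
  have hG : ∀ q, G.CDColorableWith (G.dominated b) q → l n ≠ 0 := fun q hq => (h n).2 hq.card
  rw [cdNumberWith]
  split_ifs with h0
  · refine iInf₂_eq_top.2 fun q hq => absurd h0 (hG q hq)
  · classical
    have hex : ∃ q, G.CDColorableWith (G.dominated b) q := ⟨n, (h n).1 h0⟩
    set m := Nat.find hex with hm
    have hmn : m ≤ n := Nat.find_min' hex ((h n).1 h0)
    -- Monotonicity needs a vertex, which `q < n` provides. The failing `q < n` are thus precisely
    -- those below the minimum `m`, and counting them gives `m`.
    have hup : ∀ q < n, (m ≤ q ↔ l q ≠ 0) := by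
      intro q hq
      rw [h]
      refine ⟨fun hmq => ?_, fun hq => Nat.find_min' hex hq⟩
      exact Nat.le_induction (Nat.find_spec hex) (fun k _ ih => ih.succ (by omega)) q hmq
    have hsum : ∑ q ∈ range n, (1 - l q) = m := by
      have : ∀ q ∈ range n, 1 - l q = if q < m then 1 else 0 := by
        intro q hq
        have h1 := hup q (mem_range.1 hq)
        have h2 := hl q
        split_ifs <;> omega
      rw [sum_congr rfl this, ← sum_filter, sum_const, smul_eq_mul, mul_one]
      have : (range n).filter (· < m) = range m := by ext; simp; omega
      rw [this, card_range]
    rw [hsum]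
    exact le_antisymm (iInf₂_le m (Nat.find_spec hex))
      (le_iInf₂ fun q hq => Nat.cast_le.2 (Nat.find_min' hex hq))

theorem cdChromaticNumber_eq (G : SimpleGraph (Fin n)) :
    G.cdChromaticNumber = G.cdNumberWith (G.dominated 0) := by
  rw [cdChromaticNumber]
  congr 1
  ext v u
  simp [dominated]

theorem cdChromaticNumberClosed_eq (G : SimpleGraph (Fin n)) :
    G.cdChromaticNumberClosed = G.cdNumberWith (G.dominated 1) := by
  rw [cdChromaticNumberClosed]
  congr 1
  ext v u
  simp [dominated, or_comm]

end SimpleGraph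

/-! ### Subset sum transforms and pointwise operations on the machine -/

namespace WordRAM

open BitMask

/-- The values that stay in the registers: the number `n` of vertices, some constants and addresses,
and a flag `b`. The bound `B` on the word size leaves room for products of two subset sums. -/
structure Ready (B n b : ℕ) (s : State) : Prop where
  bound : 8 * (2 ^ n * 2 ^ n) ≤ B
  flag : b ≤ 1
  r0 : s.reg 0 = n
  r2 : s.reg 2 = 2
  r3 : s.reg 3 = 1
  r4 : s.reg 4 = 2 ^ n
  r5 : s.reg 5 = n * n
  r6 : s.reg 6 = n * n + 2 ^ n
  r7 : s.reg 7 = b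

namespace Ready

variable {B n b : ℕ} {s s' : State}

theorem congr (h : Ready B n b s) (hs : ∀ r < 8, r ≠ 1 → s'.reg r = s.reg r) :
    Ready B n b s' := by
  constructor
  · exact h.bound
  · exact h.flag
  all_goals rw [hs _ (by omega) (by omega)]
  exacts [h.r0, h.r2, h.r3, h.r4, h.r5, h.r6, h.r7]

theorem set (h : Ready B n b s) {c : ℕ} (hc : 8 ≤ c) (v : ℕ) : Ready B n b (s.set c v) :=
  h.congr fun _ hr _ => State.set_reg_of_ne _ _ (by omega)

theorem sizes (h : Ready B n b s) :
    n < 2 ^ n ∧ n * n ≤ 2 ^ n * 2 ^ n ∧ 2 ^ n ≤ 2 ^ n * 2 ^ n ∧ 8 * (2 ^ n * 2 ^ n) ≤ B :=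
  ⟨Nat.lt_two_pow_self, Nat.mul_le_mul Nat.lt_two_pow_self.le Nat.lt_two_pow_self.le,
    Nat.le_mul_of_pos_left _ (by positivity), h.bound⟩

end Ready

/-- One pass of the subset sum transform (if `up`) or of its inverse, for the place with value
`reg 12`, on the array at `reg 10`. -/
def pass (up : Bool) : Prog :=
  forLoop 13 4 <| block
    [.div 14 13 12, .div 15 14 2, .mul 15 15 2, .sub 14 14 15, .mul 15 14 12, .add 16 10 13,
      .sub 17 16 15, .load 17 17, .mul 17 17 14, .load 18 16,
      if up then .add 18 18 17 else .sub 18 18 17, .store 16 18]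

theorem digit_mul_le (x p : ℕ) : digit x p * p ≤ x := by
  rcases Nat.le_one_iff_eq_zero_or_eq_one.1 (digit_le_one x p) with h | h
  · simp [h]
  · rw [h, one_mul]
    by_contra hlt
    simp [digit, Nat.div_eq_of_lt (not_le.1 hlt)] at h

/-- The array can be overwritten in place because the loop descends and the partner of `x` has an
index at most `x`, hence still holds its old value. If the digit is `0`, the partner is `x` itself
and enters with weight `0`, so no branching is needed. -/
theorem halts_pass {B n b base p : ℕ} {s : State} (up : Bool) {f φ : ℕ → ℕ}
    (hφ : φ = if up then zetaPass p f else moebiusPass p f)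
    (hs : Ready B n b s) (h10 : s.reg 10 = base) (h12 : s.reg 12 = p)
    (hbase : base + 2 ^ n ≤ B) (hf : ∀ x < 2 ^ n, s.mem (base + x) = f x)
    (hfB : ∀ x < 2 ^ n, f x < B) (hφB : ∀ x < 2 ^ n, φ x < B) :
    Halts B (pass up) s (2 ^ n * 15 + 2) fun s' =>
      (∀ r < 13, s'.reg r = s.reg r) ∧ (∀ x < 2 ^ n, s'.mem (base + x) = φ x) ∧
      ∀ y, y < base ∨ base + 2 ^ n ≤ y → s'.mem y = s.mem y := by
  obtain ⟨hz1, hz2, hz3, hz4⟩ := hs.sizes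
  refine Halts.mapLoop (T := 13) φ (by omega) hs.r3 hs.r4 (by omega) ?_
  intro x hx t ht hx13 hmem
  have e2 : t.reg 2 = 2 := by rw [ht _ (by omega), hs.r2]
  have e10 : t.reg 10 = base := by rw [ht _ (by omega), h10]
  have e12 : t.reg 12 = p := by rw [ht _ (by omega), h12]
  have hdig : ∀ x p, x / p - x / p / 2 * 2 = digit x p := fun _ _ => rfl
  have hle := digit_mul_le x p
  have em : t.mem (base + x) = f x := by rw [hmem _ (by omega), hf x hx]
  have em' : t.mem (base + x - digit x p * p) = f (x - digit x p * p) := by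
    rw [Nat.add_sub_assoc hle, hmem _ (by omega), hf _ (by omega)]
  have b1 := hfB x hx
  have b2 := hfB (x - digit x p * p) (by omega)
  have b3 : f (x - digit x p * p) * digit x p ≤ f (x - digit x p * p) :=
    (Nat.mul_le_mul_left _ (digit_le_one x p)).trans_eq (mul_one _)
  have b4 : x / p ≤ x := Nat.div_le_self x p
  have b5 := digit_le_one x p
  have b7 : x / p / 2 * 2 ≤ x / p := Nat.div_mul_le_self _ _
  have b8 : x / p / 2 ≤ x / p := Nat.div_le_self _ _
  have b9 := hφB x hx
  have hφx : φ x = if up then f x + f (x - digit x p * p) * digit x p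
      else f x - f (x - digit x p * p) * digit x p := by
    rw [hφ]; cases up <;> rfl
  rw [hφx] at b9 ⊢
  refine Halts.block ?_ ⟨fun r hr => ?_, ?_⟩
  · cases up <;>
    simp [Fits, Instr.exec, Instr.value, e2, e10, e12, hx13, hdig, em, em'] at b9 ⊢ <;> omega
  · cases up <;>
    simp (disch := omega) [execAll, Instr.exec, Function.update_of_ne]
  · cases up <;>
    simp [execAll, Instr.exec, Instr.value, e2, e10, e12, hx13, hdig, em, em']

end WordRAM

namespace WordRAM

open BitMask

/-- The subset sum transform of the array at `reg 10`. -/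
def zetaProg : Prog :=
  .seq (block [.const 12 1]) (forLoop 11 0 (.seq (pass true) (block [.add 12 12 12])))

/-- The inverse of the subset sum transform, on the array at `reg 10`. -/
def moebiusProg : Prog :=
  .seq (block [.mul 12 4 3]) (forLoop 11 0 (.seq (block [.div 12 12 2]) (pass false)))

/-- The steps of a transform. -/
def transformTime (n : ℕ) : ℕ := n * (2 ^ n * 15 + 6) + 4

variable {B n b base : ℕ} {s : State}

theorem halts_zetaProg {f : ℕ → ℕ} (hs : Ready B n b s) (h10 : s.reg 10 = base)
    (hbase : base + 2 ^ n ≤ B) (hmem : ∀ x < 2 ^ n, s.mem (base + x) = f x)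
    (hf : ∀ x < 2 ^ n, f x ≤ 1) :
    Halts B zetaProg s (transformTime n) fun s' =>
      (∀ r < 11, s'.reg r = s.reg r) ∧ (∀ x < 2 ^ n, s'.mem (base + x) = zeta f n x) ∧
      ∀ y, y < base ∨ base + 2 ^ n ≤ y → s'.mem y = s.mem y := by
  obtain ⟨hz1, hz2, hz3, hz4⟩ := hs.sizes
  have hB : ∀ i, ∀ x < 2 ^ n, zeta f i x < B := fun i x hx => by
    have := zeta_le f hf (i := i) hx
    omega
  -- The counter descends but the places ascend: with `i` rounds left, `n - i` passes are done.
  set Inv : ℕ → State → Prop := fun i t => (∀ r < 11, t.reg r = s.reg r) ∧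
    t.reg 12 = 2 ^ (n - i) ∧ (∀ x < 2 ^ n, t.mem (base + x) = zeta f (n - i) x) ∧
    ∀ y, y < base ∨ base + 2 ^ n ≤ y → t.mem y = s.mem y with hInv
  have hready : ∀ {i t}, Inv i t → Ready B n b t := fun h => hs.congr fun r hr _ => h.1 r (by omega)
  refine (Halts.seq_of (T := 2) (T' := n * (2 ^ n * 15 + 6) + 2) (R := Inv n)
    (Halts.block (l := [.const 12 1]) ?_ ⟨fun r hr => ?_, ?_, ?_, ?_⟩) fun t ht => ?_).mono
      (by unfold transformTime; omega) fun _ h => h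
  · simp [Fits, Instr.value]; omega
  · simp (disch := omega) [execAll, Instr.exec, Function.update_of_ne]
  · simp [execAll, Instr.exec, Instr.value]
  · simpa [execAll, Instr.exec, zeta] using hmem
  · simp [execAll, Instr.exec]
  refine (Halts.forLoop (T := 2 ^ n * 15 + 4) Inv (hready ht).r3 (hready ht).r0 (by omega) ?_
    (fun i t h => (hready h).r3) ht ?_).mono le_rfl fun t h => ⟨h.1, h.2.2⟩
  · rintro i t v ⟨h1, h2, h3⟩
    exact ⟨fun r hr => by rw [State.set_reg_of_ne _ _ (by omega), h1 r hr],
      by rw [State.set_reg_of_ne _ _ (by omega), h2], h3⟩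
  · intro i hi t h ht11
    have hsub : n - i = n - (i + 1) + 1 := by omega
    refine (halts_pass true (f := zeta f (n - (i + 1))) (φ := zeta f (n - i)) (by rw [hsub]; rfl)
      (hready h) ((h.1 10 (by omega)).trans h10) h.2.1 hbase h.2.2.1 (hB _) (hB _)).seq_of
      fun t' h' => Halts.block ?_ ⟨?_, fun r hr => ?_, ?_, ?_, ?_⟩
    · have : 2 ^ (n - (i + 1)) ≤ 2 ^ n := Nat.pow_le_pow_right (by omega) (by omega)
      simp [Fits, Instr.value, h'.1, h.2.1]
      omega
    · simp [execAll, Instr.exec, h'.1, ht11]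
    · simp (disch := omega) [execAll, Instr.exec, Function.update_of_ne, h'.1, h.1]
    · simp [execAll, Instr.exec, Instr.value, h'.1, h.2.1, hsub, pow_succ, mul_two]
    · simpa [execAll, Instr.exec] using h'.2.1
    · intro y hy
      simp [execAll, Instr.exec, h'.2.2 y hy, h.2.2.2 y hy]

/-- The passes are undone in reverse order, from the highest place down: `reg 12` starts at `2 ^ n`
and is halved before each pass. Every intermediate array is some `zeta h i`, bounded by `zeta h n`.
-/
theorem halts_moebiusProg {h : ℕ → ℕ} (hs : Ready B n b s) (h10 : s.reg 10 = base)
    (hbase : base + 2 ^ n ≤ B) (hmem : ∀ x < 2 ^ n, s.mem (base + x) = zeta h n x)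
    (hh : ∀ x < 2 ^ n, zeta h n x < B) :
    Halts B moebiusProg s (transformTime n) fun s' =>
      (∀ r < 11, s'.reg r = s.reg r) ∧ (∀ x < 2 ^ n, s'.mem (base + x) = h x) ∧
      ∀ y, y < base ∨ base + 2 ^ n ≤ y → s'.mem y = s.mem y := by
  obtain ⟨hz1, hz2, hz3, hz4⟩ := hs.sizes
  have hB : ∀ i ≤ n, ∀ x < 2 ^ n, zeta h i x < B := fun i hi x hx =>
    (zeta_mono h hi x).trans_lt (hh x hx)
  set Inv : ℕ → State → Prop := fun i t => (∀ r < 11, t.reg r = s.reg r) ∧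
    t.reg 12 = 2 ^ i ∧ i ≤ n ∧ (∀ x < 2 ^ n, t.mem (base + x) = zeta h i x) ∧
    ∀ y, y < base ∨ base + 2 ^ n ≤ y → t.mem y = s.mem y with hInv
  have hready : ∀ {i t}, Inv i t → Ready B n b t := fun h => hs.congr fun r hr _ => h.1 r (by omega)
  refine (Halts.seq_of (T := 2) (T' := n * (2 ^ n * 15 + 6) + 2) (R := Inv n)
    (Halts.block (l := [.mul 12 4 3]) ?_ ⟨fun r hr => ?_, ?_, le_rfl, ?_, ?_⟩) fun t ht => ?_).mono
      (by unfold transformTime; omega) fun _ h => h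
  · simp [Fits, Instr.value, hs.r4, hs.r3]; omega
  · simp (disch := omega) [execAll, Instr.exec, Function.update_of_ne]
  · simp [execAll, Instr.exec, Instr.value, hs.r4, hs.r3]
  · simpa [execAll, Instr.exec] using hmem
  · simp [execAll, Instr.exec]
  refine (Halts.forLoop (T := 2 ^ n * 15 + 4) Inv (hready ht).r3 (hready ht).r0 (by omega) ?_
    (fun i t h => (hready h).r3) ht ?_).mono le_rfl fun t h => ⟨h.1, h.2.2.2⟩
  · rintro i t v ⟨h1, h2, h3⟩
    exact ⟨fun r hr => by rw [State.set_reg_of_ne _ _ (by omega), h1 r hr],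
      by rw [State.set_reg_of_ne _ _ (by omega), h2], h3⟩
  · intro i hi t ht ht11
    have e12 : t.reg 12 / t.reg 2 = 2 ^ i := by
      rw [ht.2.1, (hready ht).r2, pow_succ, Nat.mul_div_cancel _ (by omega)]
    have hlt : 2 ^ i ≤ 2 ^ n := Nat.pow_le_pow_right (by omega) hi.le
    refine (Halts.seq_of (T := 2) (T' := 2 ^ n * 15 + 2) (R := fun t' => t' = t.set 12 (2 ^ i))
      (Halts.block ?_ ?_) ?_).mono (by omega) fun _ h => h
    · simp [Fits, Instr.value, e12]; omega
    · simp [execAll, Instr.exec, Instr.value, e12, State.set]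
    rintro _ rfl
    have hr := (hready ht).set (c := 12) (by omega) (2 ^ i)
    refine (halts_pass false (f := zeta h (i + 1)) (φ := zeta h i) (moebiusPass_zeta h i).symm
      hr ?_ (State.set_reg_self _ _ _) hbase ht.2.2.2.1 (hB _ hi) (hB _ hi.le)).mono le_rfl ?_
    · rw [State.set_reg_of_ne _ _ (by omega), ht.1 _ (by omega), h10]
    · rintro t' ⟨h1, h2, h3⟩
      refine ⟨?_, fun r hr => ?_, ?_, hi.le, h2, fun y hy => ?_⟩
      · rw [h1 _ (by omega), State.set_reg_of_ne _ _ (by omega), ht11]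
      · rw [h1 _ (by omega), State.set_reg_of_ne _ _ (by omega), ht.1 r hr]
      · rw [h1 _ (by omega), State.set_reg_self]
      · rw [h3 y hy, State.set_mem, ht.2.2.2.2 y hy]

/-- Multiply the array at `reg 6` pointwise by the array at `reg 5`. -/
def multiplyProg : Prog :=
  forLoop 10 4 <| block
    [.add 11 5 10, .load 11 11, .add 12 6 10, .load 13 12, .mul 11 11 13, .store 12 11]

theorem halts_multiplyProg {f g : ℕ → ℕ} (hs : Ready B n b s)
    (hg : ∀ x < 2 ^ n, s.mem (n * n + x) = g x)
    (hf : ∀ x < 2 ^ n, s.mem (n * n + 2 ^ n + x) = f x)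
    (hfB : ∀ x < 2 ^ n, f x ≤ 2 ^ n) (hgB : ∀ x < 2 ^ n, g x ≤ 2 ^ n) :
    Halts B multiplyProg s (2 ^ n * 9 + 2) fun s' =>
      (∀ r < 10, s'.reg r = s.reg r) ∧ (∀ x < 2 ^ n, s'.mem (n * n + 2 ^ n + x) = f x * g x) ∧
      ∀ y, y < n * n + 2 ^ n ∨ n * n + 2 ^ n + 2 ^ n ≤ y → s'.mem y = s.mem y := by
  obtain ⟨hz1, hz2, hz3, hz4⟩ := hs.sizes
  refine Halts.mapLoop (T := 7) (fun x => f x * g x) (by omega) hs.r3 hs.r4 (by omega) ?_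
  intro x hx t ht hx10 hmem
  have e5 : t.reg 5 = n * n := by rw [ht _ (by omega), hs.r5]
  have e6 : t.reg 6 = n * n + 2 ^ n := by rw [ht _ (by omega), hs.r6]
  have m1 : t.mem (n * n + x) = g x := by rw [hmem _ (by omega), hg x hx]
  have m2 : t.mem (n * n + 2 ^ n + x) = f x := by rw [hmem _ (by omega), hf x hx]
  have b1 := hfB x hx
  have b2 := hgB x hx
  have b3 : g x * f x ≤ 2 ^ n * 2 ^ n := Nat.mul_le_mul b2 b1
  refine Halts.block ?_ ⟨fun r hr => ?_, ?_⟩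
  · simp [Fits, Instr.exec, Instr.value, e5, e6, hx10, m1, m2]
    omega
  · simp (disch := omega) [execAll, Instr.exec, Function.update_of_ne]
  · simp [execAll, Instr.exec, Instr.value, e5, e6, hx10, m1, m2, mul_comm]

/-- Replace the nonzero entries of the array at `reg 6` by `1`. -/
def clampProg : Prog :=
  forLoop 10 4 <| block
    [.add 11 6 10, .load 12 11, .sub 12 3 12, .sub 12 3 12, .store 11 12]

theorem halts_clampProg {f : ℕ → ℕ} (hs : Ready B n b s)
    (hf : ∀ x < 2 ^ n, s.mem (n * n + 2 ^ n + x) = f x) (hfB : ∀ x < 2 ^ n, f x < B) :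
    Halts B clampProg s (2 ^ n * 8 + 2) fun s' =>
      (∀ r < 10, s'.reg r = s.reg r) ∧
      (∀ x < 2 ^ n, s'.mem (n * n + 2 ^ n + x) = 1 - (1 - f x)) ∧
      ∀ y, y < n * n + 2 ^ n ∨ n * n + 2 ^ n + 2 ^ n ≤ y → s'.mem y = s.mem y := by
  obtain ⟨hz1, hz2, hz3, hz4⟩ := hs.sizes
  refine Halts.mapLoop (T := 6) (fun x => 1 - (1 - f x)) (by omega) hs.r3 hs.r4 (by omega) ?_
  intro x hx t ht hx10 hmem
  have e3 : t.reg 3 = 1 := by rw [ht _ (by omega), hs.r3]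
  have e6 : t.reg 6 = n * n + 2 ^ n := by rw [ht _ (by omega), hs.r6]
  have m2 : t.mem (n * n + 2 ^ n + x) = f x := by rw [hmem _ (by omega), hf x hx]
  have b1 := hfB x hx
  refine Halts.block ?_ ⟨fun r hr => ?_, ?_⟩
  · simp [Fits, Instr.exec, Instr.value, e3, e6, hx10, m2]
    omega
  · simp (disch := omega) [execAll, Instr.exec, Function.update_of_ne]
  · simp [execAll, Instr.exec, Instr.value, e3, e6, hx10, m2]

end WordRAM

/-! ### The table of admissible masks on the machine -/

namespace WordRAM

open BitMask Finset

/-- Treat the pair `(i, j) = (reg 14, reg 17)`: add to `reg 12` its contribution to the number of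
edges in the mask `reg 10`, and to `reg 16` its contribution to the elements that `i` misses. -/
def cellProg : Prog := block
  [.div 15 15 2, .div 18 10 11, .div 19 18 2, .mul 19 19 2, .sub 18 18 19,
    .div 19 10 15, .div 20 19 2, .mul 20 20 2, .sub 19 19 20,
    .mul 20 14 0, .add 20 20 17, .load 20 20,
    .mul 18 18 19, .mul 18 18 20, .add 12 12 18,
    .sub 18 14 17, .sub 21 17 14, .add 18 18 21, .sub 18 3 18, .mul 18 18 7, .add 20 20 18,
    .sub 20 3 20, .mul 20 20 19, .add 16 16 20]

/-- Treat the vertex `reg 14`; the number of vertices that dominate the mask `reg 10` is counted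
in `reg 13`. -/
def rowProg : Prog :=
  .seq (block [.div 11 11 2, .mul 15 4 3, .const 16 0])
    (.seq (forLoop 17 0 cellProg) (block [.sub 16 3 16, .add 13 13 16]))

/-- Decide whether the mask `reg 10` is admissible. -/
def maskProg : Prog :=
  .seq (block [.mul 11 4 3, .const 12 0, .const 13 0])
    (.seq (forLoop 14 0 rowProg)
      (block [.sub 12 3 12, .sub 13 3 13, .sub 13 3 13, .mul 12 12 13, .add 13 5 10, .store 13 12]))

/-- Write the table of admissible masks to the array at `reg 5`. -/
def admissibleProg : Prog := forLoop 10 4 maskProg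

variable {B n b : ℕ} {s : State} {a : ℕ → ℕ}

/-- All case distinctions are arithmetic: `1 - (i - j + (j - i))` is the indicator of `i = j`, and
the flag `b` decides whether it counts as domination. -/
theorem halts_cellProg {x i j e d : ℕ} (hs : Ready B n b s) (hx : x < 2 ^ n) (hi : i < n)
    (hj : j < n) (ha : ∀ y, a y ≤ 1) (hmem : ∀ y < n * n, s.mem y = a y)
    (h10 : s.reg 10 = x) (h11 : s.reg 11 = 2 ^ i) (h12 : s.reg 12 = e) (h14 : s.reg 14 = i)
    (h15 : s.reg 15 = 2 ^ (j + 1)) (h16 : s.reg 16 = d) (h17 : s.reg 17 = j)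
    (he : e < n * n) (hd : d < n) :
    Halts B cellProg s 25 fun s' =>
      (∀ r < 18, r ≠ 12 → r ≠ 15 → r ≠ 16 → s'.reg r = s.reg r) ∧
      s'.reg 12 = e + digit x (2 ^ i) * digit x (2 ^ j) * a (i * n + j) ∧ s'.reg 15 = 2 ^ j ∧
      s'.reg 16 = d + (1 - (a (i * n + j) + (1 - (i - j + (j - i))) * b)) * digit x (2 ^ j) ∧
      s'.mem = s.mem := by
  obtain ⟨hz1, hz2, hz3, hz4⟩ := hs.sizes
  have e15 : 2 ^ (j + 1) / 2 = 2 ^ j := by rw [pow_succ, Nat.mul_div_cancel _ (by omega)]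
  have hdig : ∀ x p, x / p - x / p / 2 * 2 = digit x p := fun _ _ => rfl
  have hlt : i * n + j < n * n := by nlinarith
  have em := hmem _ hlt
  have hjn : 2 ^ j ≤ 2 ^ n := Nat.pow_le_pow_right (by omega) hj.le
  have b1 : x / 2 ^ i ≤ x := Nat.div_le_self _ _
  have b2 : x / 2 ^ j ≤ x := Nat.div_le_self _ _
  have b3 := digit_le_one x (2 ^ i)
  have b4 := digit_le_one x (2 ^ j)
  have b5 := ha (i * n + j)
  have b6 : digit x (2 ^ i) * digit x (2 ^ j) ≤ 1 := Nat.mul_le_mul b3 b4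
  have b7 : digit x (2 ^ i) * digit x (2 ^ j) * a (i * n + j) ≤ 1 := Nat.mul_le_mul b6 b5
  have b8 : (1 - (i - j + (j - i))) * b ≤ 1 := Nat.mul_le_mul (Nat.sub_le _ _) hs.flag
  have b9 : (1 - (a (i * n + j) + (1 - (i - j + (j - i))) * b)) * digit x (2 ^ j) ≤ 1 :=
    Nat.mul_le_mul (Nat.sub_le _ _) b4
  refine Halts.block ?_ ⟨fun r hr h12 h15 h16 => ?_, ?_, ?_, ?_, rfl⟩
  · simp [Fits, Instr.exec, Instr.value, hs.r0, hs.r2, hs.r3, hs.r7, h10, h11, h12, h14, h15, h16,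
      h17, hdig, e15, em]
    omega
  · simp (disch := omega) [execAll, Instr.exec, Function.update_of_ne]
  all_goals simp [execAll, Instr.exec, Instr.value, hs.r0, hs.r2, hs.r3, hs.r7, h10, h11, h12, h14,
    h15, h16, h17, hdig, e15, em]

theorem sum_Ico_le {f : ℕ → ℕ} {K : ℕ} (hf : ∀ k, f k ≤ K) (j n : ℕ) :
    ∑ k ∈ Ico j n, f k ≤ (n - j) * K := by
  simpa using sum_le_card_nsmul (Ico j n) f K fun k _ => hf k

theorem halts_rowProg {x i e d : ℕ} (hs : Ready B n b s) (hx : x < 2 ^ n) (hi : i < n)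
    (ha : ∀ y, a y ≤ 1) (hmem : ∀ y < n * n, s.mem y = a y)
    (h10 : s.reg 10 = x) (h11 : s.reg 11 = 2 ^ (i + 1)) (h12 : s.reg 12 = e) (h13 : s.reg 13 = d)
    (h14 : s.reg 14 = i) (he : e + n ≤ n * n) (hd : d < n) :
    Halts B rowProg s (n * 27 + 9) fun s' =>
      (∀ r < 15, r ≠ 11 → r ≠ 12 → r ≠ 13 → s'.reg r = s.reg r) ∧
      s'.reg 11 = 2 ^ i ∧
      s'.reg 12 = e + ∑ j ∈ range n, digit x (2 ^ i) * digit x (2 ^ j) * a (i * n + j) ∧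
      s'.reg 13 = d + (1 - missed n b a x i) ∧ s'.mem = s.mem := by
  obtain ⟨hz1, hz2, hz3, hz4⟩ := hs.sizes
  set F : ℕ → ℕ := fun j => digit x (2 ^ i) * digit x (2 ^ j) * a (i * n + j) with hF
  set D : ℕ → ℕ := fun j => (1 - (a (i * n + j) + (1 - (i - j + (j - i))) * b)) * digit x (2 ^ j)
    with hD
  have hF1 : ∀ j, F j ≤ 1 := fun j =>
    Nat.mul_le_mul (Nat.mul_le_mul (digit_le_one _ _) (digit_le_one _ _) : _ ≤ 1 * 1) (ha _)
  have hD1 : ∀ j, D j ≤ 1 := fun j => Nat.mul_le_mul (Nat.sub_le _ _) (digit_le_one _ _)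
  have e11 : 2 ^ (i + 1) / 2 = 2 ^ i := by rw [pow_succ, Nat.mul_div_cancel _ (by omega)]
  have hin : 2 ^ i ≤ 2 ^ n := Nat.pow_le_pow_right (by omega) hi.le
  -- The loop descends, so the partial sums run over `Ico j n` and each round adds a term at the
  -- lower end.
  set Inv : ℕ → State → Prop := fun j t =>
    (∀ r < 15, r ≠ 11 → r ≠ 12 → t.reg r = s.reg r) ∧ t.reg 11 = 2 ^ i ∧ j ≤ n ∧
    t.reg 12 = e + ∑ k ∈ Ico j n, F k ∧ t.reg 15 = 2 ^ j ∧ t.reg 16 = ∑ k ∈ Ico j n, D k ∧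
    t.mem = s.mem with hInv
  have hready : ∀ {j t}, Inv j t → Ready B n b t := fun h =>
    hs.congr fun r hr _ => h.1 r (by omega) (by omega) (by omega)
  refine (Halts.seq_of (T := 4) (T' := n * 27 + 2 + 3) (R := Inv n)
    (Halts.block (l := [.div 11 11 2, .mul 15 4 3, .const 16 0]) ?_
    ⟨fun r hr h11 h12 => ?_, ?_, le_rfl, ?_, ?_, ?_, ?_⟩) fun t ht => ?_).mono (by omega)
    fun _ h => h
  · simp [Fits, Instr.exec, Instr.value, h11, hs.r2, hs.r3, hs.r4, e11]
    omega
  · simp (disch := omega) [execAll, Instr.exec, Function.update_of_ne]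
  · simp [execAll, Instr.exec, Instr.value, h11, hs.r2, e11]
  · simp [execAll, Instr.exec, h12]
  · simp [execAll, Instr.exec, Instr.value, hs.r4, hs.r3]
  · simp [execAll, Instr.exec, Instr.value]
  · simp [execAll, Instr.exec]
  refine Halts.seq_of (R := Inv 0) (Halts.forLoop (T := 25) Inv (hready ht).r3 (hready ht).r0
    (by omega) ?_ (fun j t h => (hready h).r3) ht ?_) ?_
  · rintro j t v ⟨h1, h2, h3, h4, h5, h6, h7⟩
    refine ⟨fun r hr hr1 hr2 => ?_, ?_, h3, ?_, ?_, ?_, h7⟩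
    · rw [State.set_reg_of_ne _ _ (by omega), h1 r hr hr1 hr2]
    all_goals rwa [State.set_reg_of_ne _ _ (by omega)]
  · intro j hj t h ht17
    obtain ⟨h1, h2, h3, h4, h5, h6, h7⟩ := id h
    have hs1 := sum_Ico_le hF1 (j + 1) n
    have hs2 := sum_Ico_le hD1 (j + 1) n
    refine (halts_cellProg (a := a) (hready h) hx hi hj ha (by rwa [h7]) ?_ h2 h4 ?_ h5 h6 ht17
      (by omega) (by omega)).mono le_rfl ?_
    · rw [h1 _ (by omega) (by omega) (by omega), h10]
    · rw [h1 _ (by omega) (by omega) (by omega), h14]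
    rintro t' ⟨g1, g2, g3, g4, g5⟩
    refine ⟨?_, fun r hr hr1 hr2 => ?_, ?_, hj.le, ?_, g3, ?_, g5.trans h7⟩
    · rw [g1 _ (by omega) (by omega) (by omega) (by omega), ht17]
    · rw [g1 _ (by omega) (by omega) (by omega) (by omega), h1 _ hr hr1 hr2]
    · rw [g1 _ (by omega) (by omega) (by omega) (by omega), h2]
    · rw [g2, sum_eq_sum_Ico_succ_bot hj, add_comm (F j), ← add_assoc]
    · rw [g4, sum_eq_sum_Ico_succ_bot hj, add_comm (D j)]
  · intro t h
    obtain ⟨h1, h2, -, h4, -, h6, h7⟩ := id h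
    rw [← range_eq_Ico] at h4 h6
    have h3 := (hready h).r3
    have h13' : t.reg 13 = d := by rw [h1 _ (by omega) (by omega) (by omega), h13]
    refine Halts.block ?_ ⟨fun r hr h11 h12 h13 => ?_, ?_, ?_, ?_, ?_⟩
    · simp [Fits, Instr.exec, Instr.value, h3, h13']
      omega
    · simp (disch := omega) [execAll, Instr.exec, Function.update_of_ne, h1]
    · simp [execAll, Instr.exec, h2]
    · simp [execAll, Instr.exec, h4]
    · simp [execAll, Instr.exec, Instr.value, h3, h13', h6, missed, D]
    · simp [execAll, Instr.exec, h7]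

/-- The steps of `maskProg`. -/
def maskTime (n : ℕ) : ℕ := n * (n * 27 + 11) + 13

theorem halts_maskProg {x : ℕ} (hs : Ready B n b s) (hx : x < 2 ^ n)
    (ha : ∀ y, a y ≤ 1) (hmem : ∀ y < n * n, s.mem y = a y) (h10 : s.reg 10 = x) :
    Halts B maskProg s (maskTime n) fun s' =>
      (∀ r < 11, s'.reg r = s.reg r) ∧
      s'.mem = Function.update s.mem (n * n + x) (admissible n b a x) := by
  obtain ⟨hz1, hz2, hz3, hz4⟩ := hs.sizes
  set F : ℕ → ℕ := fun i => ∑ j ∈ range n, digit x (2 ^ i) * digit x (2 ^ j) * a (i * n + j) with hF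
  set D : ℕ → ℕ := fun i => 1 - missed n b a x i with hD
  have hF1 : ∀ i, F i ≤ n := fun i => by
    have := sum_Ico_le (f := fun j => digit x (2 ^ i) * digit x (2 ^ j) * a (i * n + j)) (K := 1)
      (fun j =>
        Nat.mul_le_mul (Nat.mul_le_mul (digit_le_one _ _) (digit_le_one _ _) : _ ≤ 1 * 1) (ha _))
      0 n
    rw [← range_eq_Ico] at this
    simpa using this
  have hD1 : ∀ i, D i ≤ 1 := fun i => Nat.sub_le _ _
  set Inv : ℕ → State → Prop := fun i t => (∀ r < 11, t.reg r = s.reg r) ∧ i ≤ n ∧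
    t.reg 11 = 2 ^ i ∧ t.reg 12 = ∑ k ∈ Ico i n, F k ∧ t.reg 13 = ∑ k ∈ Ico i n, D k ∧
    t.mem = s.mem with hInv
  have hready : ∀ {j t}, Inv j t → Ready B n b t := fun h => hs.congr fun r hr _ => h.1 r (by omega)
  refine (Halts.seq_of (T := 4) (T' := n * (n * 27 + 11) + 2 + 7) (R := Inv n)
    (Halts.block (l := [.mul 11 4 3, .const 12 0, .const 13 0]) ?_
    ⟨fun r hr => ?_, le_rfl, ?_, ?_, ?_, ?_⟩) fun t ht => ?_).mono (by unfold maskTime; omega)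
    fun _ h => h
  · simp [Fits, Instr.value, hs.r3, hs.r4]
    omega
  · simp (disch := omega) [execAll, Instr.exec, Function.update_of_ne]
  · simp [execAll, Instr.exec, Instr.value, hs.r4, hs.r3]
  · simp [execAll, Instr.exec, Instr.value]
  · simp [execAll, Instr.exec, Instr.value]
  · simp [execAll, Instr.exec]
  refine Halts.seq_of (R := Inv 0) (Halts.forLoop (T := n * 27 + 9) Inv (hready ht).r3
    (hready ht).r0 (by omega) ?_ (fun j t h => (hready h).r3) ht ?_) ?_
  · rintro i t v ⟨h1, h2, h3, h4, h5, h6⟩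
    refine ⟨fun r hr => ?_, h2, ?_, ?_, ?_, h6⟩
    · rw [State.set_reg_of_ne _ _ (by omega), h1 r hr]
    all_goals rwa [State.set_reg_of_ne _ _ (by omega)]
  · intro i hi t h ht14
    obtain ⟨h1, h2, h3, h4, h5, h6⟩ := id h
    -- At most `n - 1` rows have been treated, each contributing at most `n`, so there is room for
    -- one more row below `n * n`.
    have hs1 : ∑ k ∈ Ico (i + 1) n, F k + n ≤ n * n := by
      have := sum_Ico_le hF1 (i + 1) n
      have h7 : (n - (i + 1)) * n + n ≤ n * n := by
        rw [← Nat.succ_mul]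
        exact Nat.mul_le_mul_right _ (by omega)
      omega
    have hs2 := sum_Ico_le hD1 (i + 1) n
    refine (halts_rowProg (a := a) (hready h) hx hi ha (by rwa [h6]) ((h1 _ (by omega)).trans h10)
      h3 h4 h5 ht14 hs1 (by omega)).mono le_rfl ?_
    rintro t' ⟨g1, g2, g3, g4, g5⟩
    refine ⟨?_, fun r hr => ?_, hi.le, g2, ?_, ?_, g5.trans h6⟩
    · rw [g1 _ (by omega) (by omega) (by omega) (by omega), ht14]
    · rw [g1 _ (by omega) (by omega) (by omega) (by omega), h1 _ hr]
    · rw [g3, sum_eq_sum_Ico_succ_bot hi, add_comm (F i)]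
    · rw [g4, sum_eq_sum_Ico_succ_bot hi, add_comm (D i)]
  · intro t h
    obtain ⟨h1, -, -, h4, h5, h6⟩ := id h
    rw [← range_eq_Ico] at h4 h5
    have e3 := (hready h).r3
    have e5 := (hready h).r5
    have e10 : t.reg 10 = x := by rw [h1 _ (by omega), h10]
    have h7 : t.reg 12 = edgeCount n a x := h4
    have h8 : t.reg 13 = dominatorCount n b a x := h5
    have h9 : (1 - edgeCount n a x) * (1 - (1 - dominatorCount n b a x)) ≤ 1 :=
      admissible_le_one n b a x
    refine Halts.block ?_ ⟨fun r hr => ?_, ?_⟩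
    · simp [Fits, Instr.exec, Instr.value, e3, e5, e10, h7, h8]
      omega
    · simp (disch := omega) [execAll, Instr.exec, Function.update_of_ne, h1]
    · simp [execAll, Instr.exec, Instr.value, e3, e5, e10, h7, h8, h6, admissible]

theorem halts_admissibleProg (hs : Ready B n b s) (ha : ∀ y, a y ≤ 1)
    (hmem : ∀ y < n * n, s.mem y = a y) :
    Halts B admissibleProg s (2 ^ n * (maskTime n + 2) + 2) fun s' =>
      (∀ r < 10, s'.reg r = s.reg r) ∧
      (∀ x < 2 ^ n, s'.mem (n * n + x) = admissible n b a x) ∧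
      ∀ y, y < n * n ∨ n * n + 2 ^ n ≤ y → s'.mem y = s.mem y := by
  obtain ⟨hz1, hz2, hz3, hz4⟩ := hs.sizes
  refine Halts.mapLoop _ (by omega) hs.r3 hs.r4 (by omega) ?_
  intro x hx t ht hx10 ht'
  exact halts_maskProg (hs.congr fun r hr _ => ht r (by omega)) hx ha
    (fun y hy => by rw [ht' y (by omega), hmem y hy]) hx10

end WordRAM

/-! ### The level recursion and the complete program -/

namespace WordRAM

open BitMask Finset

variable {B n b : ℕ} {s : State} {a g : ℕ → ℕ}

/-- Pass from the masks that are unions of `q` admissible ones to those that are unions of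
`q + 1`. -/
def levelProg : Prog :=
  .seq (block [.mul 10 6 3]) <| .seq zetaProg <| .seq multiplyProg <|
    .seq (block [.mul 10 6 3]) <| .seq moebiusProg clampProg

/-- The steps of `levelProg`. -/
def levelTime (n : ℕ) : ℕ := 2 * transformTime n + 2 ^ n * 17 + 8

theorem halts_levelProg {q : ℕ} (hs : Ready B n b s) (hg : ∀ x < 2 ^ n, g x ≤ 1)
    (hmemg : ∀ x < 2 ^ n, s.mem (n * n + x) = zeta g n x)
    (hmem : ∀ x < 2 ^ n, s.mem (n * n + 2 ^ n + x) = level n g q x) :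
    Halts B levelProg s (levelTime n) fun s' =>
      (∀ r < 10, s'.reg r = s.reg r) ∧
      (∀ x < 2 ^ n, s'.mem (n * n + 2 ^ n + x) = level n g (q + 1) x) ∧
      ∀ y < n * n + 2 ^ n, s'.mem y = s.mem y := by
  obtain ⟨hz1, hz2, hz3, hz4⟩ := hs.sizes
  have hbase : n * n + 2 ^ n + 2 ^ n ≤ B := by omega
  have hl1 := fun x => level_le_one n g q x
  have hzl : ∀ x < 2 ^ n, zeta (level n g q) n x ≤ 2 ^ n := fun x hx => by
    simpa using zeta_le (level n g q) (fun x _ => hl1 x) (i := n) hx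
  have hzg : ∀ x < 2 ^ n, zeta g n x ≤ 2 ^ n := fun x hx => by
    simpa using zeta_le g hg (i := n) hx
  -- The largest numbers that occur in the arrays: a product of two transforms of `0`-`1` tables is
  -- at most `4 ^ n`.
  have hcov : ∀ x < 2 ^ n, zeta (coverProduct n (level n g q) g) n x < B := fun x hx => by
    rw [zeta_coverProduct _ _ hx]
    have : zeta (level n g q) n x * zeta g n x ≤ 2 ^ n * 2 ^ n :=
      Nat.mul_le_mul (hzl x hx) (hzg x hx)
    omega
  have hset : ∀ {t : State}, Ready B n b t → Halts B (block [.mul 10 6 3]) t 2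
      fun t' => t' = t.set 10 (n * n + 2 ^ n) := fun {t} ht => by
    refine Halts.block ?_ ?_
    · simp [Fits, Instr.value, ht.r6, ht.r3]; omega
    · simp [execAll, Instr.exec, Instr.value, ht.r6, ht.r3, State.set]
  refine Halts.mono (T := 2 + (transformTime n + ((2 ^ n * 9 + 2) + (2 + (transformTime n +
    (2 ^ n * 8 + 2)))))) ((hset hs).seq_of ?_) (by unfold levelTime; omega) fun _ h => h
  rintro _ rfl
  have hs1 := hs.set (c := 10) (by omega) (n * n + 2 ^ n)
  refine (halts_zetaProg hs1 (State.set_reg_self _ _ _) hbase hmem fun x _ => hl1 x).seq_of ?_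
  rintro t2 ⟨r2, m2, o2⟩
  have hs2 : Ready B n b t2 := hs1.congr fun r hr _ => r2 r (by omega)
  refine (halts_multiplyProg hs2 (fun x hx => ?_) m2 hzl hzg).seq_of ?_
  · rw [o2 _ (by omega), State.set_mem, hmemg x hx]
  rintro t3 ⟨r3, m3, o3⟩
  have hs3 : Ready B n b t3 := hs2.congr fun r hr _ => r3 r (by omega)
  refine (hset hs3).seq_of ?_
  rintro _ rfl
  have hs4 := hs3.set (c := 10) (by omega) (n * n + 2 ^ n)
  refine (halts_moebiusProg hs4 (State.set_reg_self _ _ _) hbase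
    (h := coverProduct n (level n g q) g) (fun x hx => ?_) hcov).seq_of ?_
  · rw [State.set_mem, m3 x hx, zeta_coverProduct _ _ hx]
  rintro t5 ⟨r5, m5, o5⟩
  have hs5 : Ready B n b t5 := hs4.congr fun r hr _ => r5 r (by omega)
  -- Since `zeta h 0 = h`, the cover product itself is bounded by its transform.
  refine (halts_clampProg hs5 m5 fun x hx =>
    (zeta_mono _ (Nat.zero_le n) x).trans_lt (hcov x hx)).mono le_rfl ?_
  rintro t6 ⟨r6, m6, o6⟩
  refine ⟨fun r hr => ?_, m6, fun y hy => ?_⟩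
  · rw [r6 r hr, r5 r (by omega), State.set_reg_of_ne _ _ (by omega), r3 r hr, r2 r (by omega),
      State.set_reg_of_ne _ _ (by omega)]
  · rw [o6 y (by omega), o5 y (by omega), State.set_mem, o3 y (by omega), o2 y (by omega),
      State.set_mem]

/-- Count in `reg 1` the levels that do not reach the full mask, and leave in `reg 0` the indicator
of the last level at the full mask. -/
def countProg : Prog :=
  .seq (forLoop 8 0 (.seq
      (block [.add 9 6 4, .sub 9 9 3, .load 9 9, .sub 9 3 9, .add 1 1 9]) levelProg))
    (block [.add 9 6 4, .sub 9 9 3, .load 0 9])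

/-- The steps of `countProg`. -/
def countTime (n : ℕ) : ℕ := n * (levelTime n + 8) + 6

/-- Each round reads level `q` at the full mask before advancing to `q + 1`, so levels `0, …, n - 1`
are counted and level `n` is left for the final load. That load is the last instruction because it
overwrites `n` in `reg 0`. -/
theorem halts_countProg (hs : Ready B n b s) (hg : ∀ x < 2 ^ n, g x ≤ 1) (h1 : s.reg 1 = 0)
    (hmemg : ∀ x < 2 ^ n, s.mem (n * n + x) = zeta g n x)
    (hmem : ∀ x < 2 ^ n, s.mem (n * n + 2 ^ n + x) = level n g 0 x) :
    Halts B countProg s (countTime n) fun s' =>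
      s'.reg 0 = level n g n (2 ^ n - 1) ∧
      s'.reg 1 = ∑ q ∈ range n, (1 - level n g q (2 ^ n - 1)) := by
  obtain ⟨hz1, hz2, hz3, hz4⟩ := hs.sizes
  set Inv : ℕ → State → Prop := fun k t => Ready B n b t ∧
    t.reg 1 = ∑ q ∈ range (n - k), (1 - level n g q (2 ^ n - 1)) ∧
    (∀ x < 2 ^ n, t.mem (n * n + x) = zeta g n x) ∧
    ∀ x < 2 ^ n, t.mem (n * n + 2 ^ n + x) = level n g (n - k) x with hInv
  have hfull : n * n + 2 ^ n + 2 ^ n - 1 = n * n + 2 ^ n + (2 ^ n - 1) := by omega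
  have hl1 := fun q => level_le_one n g q (2 ^ n - 1)
  refine Halts.mono (T := (n * (levelTime n + 6 + 2) + 2) + 4) ((Halts.forLoop Inv hs.r3 hs.r0
    (by omega) ?_ (fun _ _ h => h.1.r3) ⟨hs, ?_, hmemg, ?_⟩ ?_).seq_of ?_)
    (le_of_eq (by unfold countTime; ring)) fun _ h => h
  · rintro k t v ⟨ht, h2, h3⟩
    exact ⟨ht.set (by omega) v, by rwa [State.set_reg_of_ne _ _ (by omega)], h3⟩
  · simp [h1]
  · simpa using hmem
  · rintro k hk t ⟨ht, h2, h3, h4⟩ ht8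
    have hm := h4 (2 ^ n - 1) (by omega)
    have hsum : ∑ q ∈ range (n - (k + 1)), (1 - level n g q (2 ^ n - 1)) ≤ n := by
      refine (sum_le_card_nsmul _ _ 1 fun q _ => Nat.sub_le _ _).trans ?_
      simp
    have hl := hl1 (n - (k + 1))
    refine (Halts.seq_of (T := 6) (T' := levelTime n)
      (R := fun t' => (∀ r < 9, r ≠ 1 → t'.reg r = t.reg r) ∧ t'.mem = t.mem ∧
        t'.reg 1 = t.reg 1 + (1 - level n g (n - (k + 1)) (2 ^ n - 1)))
      (Halts.block (l := [.add 9 6 4, .sub 9 9 3, .load 9 9, .sub 9 3 9, .add 1 1 9]) ?_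
        ⟨fun r hr hr1 => ?_, ?_, ?_⟩) ?_).mono (by omega) fun _ h => h
    · simp [Fits, Instr.exec, Instr.value, ht.r6, ht.r4, ht.r3, hfull, hm, h2]
      omega
    · simp (disch := omega) [execAll, Instr.exec, Function.update_of_ne]
    · simp [execAll, Instr.exec]
    · simp [execAll, Instr.exec, Instr.value, ht.r6, ht.r4, ht.r3, hfull, hm]
    · rintro t' ⟨h5, h6, h7⟩
      have ht' := ht.congr fun r hr hr1 => h5 r (by omega) hr1
      refine (halts_levelProg (q := n - (k + 1)) ht' hg (by rwa [h6]) (by rwa [h6])).mono le_rfl ?_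
      have hsub : n - k = n - (k + 1) + 1 := by omega
      rintro t'' ⟨r5, m5, o5⟩
      refine ⟨?_, ht'.congr fun r hr _ => r5 r (by omega), ?_, fun x hx => ?_, ?_⟩
      · rw [r5 8 (by omega), h5 8 (by omega) (by omega), ht8]
      · rw [r5 1 (by omega), h7, h2, hsub, sum_range_succ]
      · rw [o5 _ (by omega), h6, h3 x hx]
      · rwa [hsub]
  · rintro t ⟨ht, h2, -, h4⟩
    have hm := h4 (2 ^ n - 1) (by omega)
    have hl := hl1 (n - 0)
    refine Halts.block ?_ ⟨?_, ?_⟩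
    · simp [Fits, Instr.exec, Instr.value, ht.r6, ht.r4, ht.r3, hfull, hm]
      rw [Nat.sub_zero] at hl
      omega
    · simp [execAll, Instr.exec, Instr.value, ht.r6, ht.r4, ht.r3, hfull, hm]
    · simp [execAll, Instr.exec, h2]

/-- Fill the registers as described by `Ready`, and start the array at `reg 6` with the table of the
empty union. -/
def initProg (b : ℕ) : Prog :=
  .seq (block [.const 2 2, .const 3 1, .mul 5 0 0, .const 7 b, .const 4 1]) <|
    .seq (forLoop 8 0 (block [.add 4 4 4])) (block [.add 6 5 4, .store 6 3])

theorem halts_initProg (hB : 8 * (2 ^ n * 2 ^ n) ≤ B) (hb : b ≤ 1) (h0 : s.reg 0 = n)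
    (h1 : s.reg 1 = 0) (hmem : ∀ y, n * n ≤ y → s.mem y = 0) :
    Halts B (initProg b) s (n * 4 + 11) fun s' =>
      Ready B n b s' ∧ s'.reg 1 = 0 ∧ (∀ y < n * n, s'.mem y = s.mem y) ∧
      ∀ x, s'.mem (n * n + 2 ^ n + x) = 1 - x := by
  have hz1 : n < 2 ^ n := Nat.lt_two_pow_self
  have hz2 : n * n ≤ 2 ^ n * 2 ^ n := Nat.mul_le_mul hz1.le hz1.le
  have hz3 : 2 ^ n ≤ 2 ^ n * 2 ^ n := Nat.le_mul_of_pos_left _ (by positivity)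
  set Inv : ℕ → State → Prop := fun k t => t.mem = s.mem ∧ t.reg 0 = n ∧ t.reg 1 = 0 ∧
    t.reg 2 = 2 ∧ t.reg 3 = 1 ∧ t.reg 5 = n * n ∧ t.reg 7 = b ∧ t.reg 4 = 2 ^ (n - k) with hInv
  refine Halts.mono (T := 6 + (n * 4 + 2 + 3)) (Halts.seq_of (R := Inv n) ?_ fun t ht => ?_)
    (by omega) fun _ h => h
  · refine Halts.block ?_ ?_
    · simp [Fits, Instr.exec, Instr.value, h0]
      omega
    · simp [Inv, execAll, Instr.exec, Instr.value, h0, h1]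
  refine (Halts.forLoop (T := 2) Inv ht.2.2.2.2.1 ht.2.1 (by omega) ?_ (fun _ _ h => h.2.2.2.2.1)
    ht ?_).seq_of ?_
  · rintro k t v ⟨h, h'⟩
    refine ⟨h, ?_⟩
    simpa (disch := omega) only [State.set_reg_of_ne] using h'
  · rintro k hk t ⟨e, e0, e1, e2, e3, e5, e7, e4⟩ ht8
    have hsub : n - k = n - (k + 1) + 1 := by omega
    have : 2 ^ (n - (k + 1)) ≤ 2 ^ n := Nat.pow_le_pow_right (by omega) (by omega)
    refine Halts.block ?_ ⟨?_, ?_⟩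
    · simp [Fits, Instr.value, e4]
      omega
    · simp [execAll, Instr.exec, ht8]
    · simp [Inv, execAll, Instr.exec, Instr.value, e, e0, e1, e2, e3, e5, e7, e4, hsub, pow_succ,
        mul_two]
  · rintro t ⟨e, e0, e1, e2, e3, e5, e7, e4⟩
    rw [Nat.sub_zero] at e4
    refine Halts.block ?_ ⟨⟨hB, hb, ?_, ?_, ?_, ?_, ?_, ?_, ?_⟩, ?_, fun y hy => ?_, fun x => ?_⟩
    · simp [Fits, Instr.exec, Instr.value, e3, e5, e4]
      omega
    all_goals simp [execAll, Instr.exec, Instr.value, e0, e1, e2, e3, e5, e7, e4]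
    · rw [Function.update_of_ne (by omega), e]
    -- Level `0` is nonzero only at the empty mask: a single `1` is stored, and the other cells are
    -- still `0` because the input ends before address `n * n`.
    · rcases x with _ | x
      · simp
      · rw [Function.update_of_ne (by omega), e, hmem _ (by omega)]
        omega

/-- The program for the class domination chromatic number, in the closed version if `b = 1`. -/
def cdProg (b : ℕ) : Prog :=
  .seq (initProg b) <| .seq admissibleProg <| .seq (block [.mul 10 5 3]) <| .seq zetaProg countProg

/-- The steps of `cdProg`. -/
def cdTime (n : ℕ) : ℕ :=
  (n * 4 + 11) + ((2 ^ n * (maskTime n + 2) + 2) + (2 + (transformTime n + countTime n)))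

theorem input_mem_le_one (G : SimpleGraph (Fin n)) (y : ℕ) : (input G).mem y ≤ 1 := by
  simp only [input]
  split <;> omega

theorem input_mem_eq_zero (G : SimpleGraph (Fin n)) {y : ℕ} (hy : n * n ≤ y) :
    (input G).mem y = 0 := by
  simp only [input]
  rw [if_neg]
  rintro ⟨i, j, -, rfl⟩
  have := i.2
  have := j.2
  nlinarith

theorem halts_cdProg (hB : 8 * (2 ^ n * 2 ^ n) ≤ B) (hb : b ≤ 1) (G : SimpleGraph (Fin n)) :
    Halts B (cdProg b) (input G) (cdTime n) fun s =>
      s.reg 0 = level n (admissible n b (input G).mem) n (2 ^ n - 1) ∧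
      s.reg 1 = ∑ q ∈ range n, (1 - level n (admissible n b (input G).mem) q (2 ^ n - 1)) := by
  refine (halts_initProg hB hb rfl rfl fun y => input_mem_eq_zero G).seq_of ?_
  rintro s ⟨hs, h1, hlow, hhigh⟩
  obtain ⟨hz1, hz2, hz3, hz4⟩ := hs.sizes
  refine (halts_admissibleProg hs (input_mem_le_one G) hlow).seq_of ?_
  rintro t ⟨ht, hta, hto⟩
  have hst : Ready B n b t := hs.congr fun r hr _ => ht r (by omega)
  refine Halts.seq_of (R := fun t' => t' = t.set 10 (n * n)) (Halts.block ?_ ?_) ?_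
  · simp [Fits, Instr.value, hst.r5, hst.r3]
    omega
  · simp [execAll, Instr.exec, Instr.value, hst.r5, hst.r3, State.set]
  rintro _ rfl
  have hst' := hst.set (c := 10) (by omega) (n * n)
  have hadm : ∀ x < 2 ^ n, admissible n b (input G).mem x ≤ 1 := fun x _ =>
    admissible_le_one _ _ _ x
  refine (halts_zetaProg hst' (State.set_reg_self _ _ _) (by omega) hta hadm).seq_of ?_
  rintro u ⟨hu, hua, huo⟩
  refine halts_countProg (hst'.congr fun r hr _ => hu r (by omega)) hadm ?_ hua fun x hx => ?_
  · rw [hu _ (by omega), State.set_reg_of_ne _ _ (by omega), ht _ (by omega), h1]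
  · rw [huo _ (by omega), State.set_mem, hto _ (by omega), hhigh x, level]

theorem computesInTime_cdProg (hb : b ≤ 1) :
    ComputesInTime (cdProg b) (fun _ G => G.cdNumberWith (G.dominated b)) cdTime := by
  -- The constant `3` works because `8 * 4 ^ n = 2 ^ (2 * n + 3) ≤ 2 ^ (3 * (n + 1))`.
  refine ⟨3, fun n G => ?_⟩
  have hB : 8 * (2 ^ n * 2 ^ n) ≤ 2 ^ (3 * (n + 1)) := by
    have : 8 * (2 ^ n * 2 ^ n) = 2 ^ (n + n + 3) := by ring
    rw [this]
    exact Nat.pow_le_pow_right (by omega) (by omega)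
  obtain ⟨t, s, hr, ht, h0, h1⟩ := halts_cdProg hB hb G
  refine ⟨t, s, hr, ht, ?_⟩
  rw [output, h0, h1]
  exact (G.cdNumberWith_eq b (fun q => level_le_one _ _ q _) fun q =>
    G.level_full_ne_zero_iff b q).symm

/-- Expanded, the time is a combination of terms `n ^ k` and `2 ^ n * n ^ k` with `k ≤ 2`, each at
most `2 ^ n * n ^ 4`; the constant is generous. -/
theorem cdTime_le {n : ℕ} (hn : 1 ≤ n) : cdTime n ≤ 1000 * (2 ^ n * n ^ 4) := by
  have h2 : 1 ≤ 2 ^ n := Nat.one_le_two_pow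
  have hle : ∀ k ≤ 2, n ^ k ≤ n ^ 4 := fun k hk => Nat.pow_le_pow_right hn (by omega)
  have h0 := hle 0 (by omega)
  have h1 := hle 1 (by omega)
  have h3 := hle 2 (by omega)
  have e0 := Nat.mul_le_mul h2 h0
  have e1 := Nat.mul_le_mul h2 h1
  have f0 := Nat.mul_le_mul_left (2 ^ n) h0
  have f1 := Nat.mul_le_mul_left (2 ^ n) h1
  have f3 := Nat.mul_le_mul_left (2 ^ n) h3
  have e3 := Nat.mul_le_mul h2 h3
  simp only [cdTime, maskTime, transformTime, countTime, levelTime]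
  ring_nf at *
  omega

theorem isBigO_cdTime : (fun n : ℕ => (cdTime n : ℝ)) =O[atTop]
    (fun n : ℕ => (2 : ℝ) ^ n * (n : ℝ) ^ 4 * Real.log (n : ℝ)) := by
  refine IsBigO.of_bound 1000 ?_
  -- The logarithm is pure slack: from `n = 3 > e` on it is at least `1`.
  filter_upwards [eventually_ge_atTop 3] with n hn
  have hlog : 1 ≤ Real.log n := by
    rw [Real.le_log_iff_exp_le (by positivity)]
    exact Real.exp_one_lt_three.le.trans (by exact_mod_cast hn)
  have h : (cdTime n : ℝ) ≤ 1000 * (2 ^ n * n ^ 4) := by exact_mod_cast cdTime_le (by omega)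
  have hpos : (0 : ℝ) ≤ 2 ^ n * n ^ 4 := by positivity
  rw [Real.norm_of_nonneg (by positivity), Real.norm_of_nonneg (by positivity)]
  exact h.trans (mul_le_mul_of_nonneg_left (le_mul_of_one_le_right hpos hlog) (by norm_num))

end WordRAM

theorem mainTheorem1 :
    (∃ (p : WordRAM.Prog) (T : ℕ → ℕ),
      WordRAM.ComputesInTime p (fun _ G => G.cdChromaticNumber) T ∧
      (fun n : ℕ => (T n : ℝ)) =O[atTop]
        (fun n : ℕ => (2 : ℝ) ^ n * (n : ℝ) ^ 4 * Real.log (n : ℝ))) ∧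
    (∃ (p : WordRAM.Prog) (T : ℕ → ℕ),
      WordRAM.ComputesInTime p (fun _ G => G.cdChromaticNumberClosed) T ∧
      (fun n : ℕ => (T n : ℝ)) =O[atTop]
        (fun n : ℕ => (2 : ℝ) ^ n * (n : ℝ) ^ 4 * Real.log (n : ℝ))) := by
  simp only [SimpleGraph.cdChromaticNumber_eq, SimpleGraph.cdChromaticNumberClosed_eq]
  exact ⟨⟨_, _, WordRAM.computesInTime_cdProg zero_le_one, WordRAM.isBigO_cdTime⟩,
    ⟨_, _, WordRAM.computesInTime_cdProg le_rfl, WordRAM.isBigO_cdTime⟩⟩
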